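/- Let $\mathcal T$ be a good partially truncated triangulation of an oriented 3-manifold $N$: finitely many tetrahedra $\Delta$ are glued by orientation-reversing simplicial pairings of their faces (no face glued to itself, no edge glued to itself with reversed direction); the truncated tetrahedra form a compact oriented manifold $\overline N$ whose boundary components are the vertex links; a vertex is called ideal if its link is a torus, $N$ is $\overline N$ minus its boundary tori, and good means that every tetrahedron has at most one ideal vertex. Let $t$ be the number of tetrahedra, $p$ the number of those having an ideal vertex, $l$ the number of edges of $\mathcal T$ in $N$ without ideal endpoints (compact edges) and $k$ the number of boundary tori. Let $\mathcal W\subset\mathbb R^{6t}$ be the set of dihedral angle assignments $\theta$ with values in $(0,\pi)$ on the edges of the tetrahedra such that the three angles at each vertex have sum $\pi$ if the vertex is ideal and sum $<\pi$ otherwise; it is an open subset of an affine subspace of dimension $6t-p$ and parametrizes the geometric realizations of the tetrahedra. For an edge $ab$ without ideal endpoints of a tetrahedron with vertices $a,b,c,d$, its length is given by $$\cosh L^\theta(ab)=\frac{\cos\theta_{ab}(\cos\theta_{ad}\cos\theta_{bc}+\cos\theta_{ac}\cos\theta_{bd})+\cos\theta_{ac}\cos\theta_{bc}+\cos\theta_{ad}\cos\theta_{bd}+\cos\theta_{cd}\sin^2\theta_{ab}}{\sqrt{d^\theta(a)\,d^\theta(b)}},$$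 where $d^\theta(v)=2\cos\alpha\cos\beta\cos\gamma+\cos^2\alpha+\cos^2\beta+\cos^2\gamma-1$ if $\alpha,\beta,\gamma$ are the angles along the edges at $v$. For a face $vab$ with ideal vertex $v$ and positive cyclic order $(v,a,b)$ in a tetrahedron with remaining vertex $i$, set $\sigma^\theta(vab)=\ln(\sinh L_a/\sinh L_b)$, where $L_a, L_b\ge 0$ are the lengths of the boundary edges of the face at $a$ and $b$, i.e. $$\cosh L_a=\frac{\cos\theta_{av}\cos\theta_{ab}+\cos\theta_{ai}}{\sin\theta_{av}\sin\theta_{ab}},\qquad \cosh L_b=\frac{\cos\theta_{bv}\cos\theta_{ba}+\cos\theta_{bi}}{\sin\theta_{bv}\sin\theta_{ba}}.$$ Choose, for each compact edge of $\mathcal T$, one representative $e'$ among the edges of tetrahedra glued to it, and, for each boundary torus, one pair of glued faces having an ideal vertex on that torus. Let $F$ be the map on $\mathcal W$ whose components are $L^\theta(e)-L^\theta(e')$, for all compact edges $e$ of tetrahedra other than the representatives ($e'$ being the representative of the class of $e$), and $\sigma^\theta(G)+\sigma^\theta(G')$, for all unordered pairs $\{G,G'\}$ of glued faces with an ideal vertex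 other than the chosen ones. Let $\Omega_{\rm c}(\mathcal T)=F^{-1}(0)\subset\mathcal W$ be the space of cone structures. Then $p$ is even, $F$ has exactly $6t-l-\frac32p-k$ components and is smooth, and for every $x\in\mathcal W$ the differential $dF_x\colon T_x\mathcal W\to\mathbb R^{6t-l-\frac32p-k}$ has maximal rank (it is surjective). Consequently $\Omega_{\rm c}(\mathcal T)$ is a smooth (embedded) manifold of real dimension $l+\frac p2+k$ near each of its points. In particular this holds at the point $x_0\in\Omega_{\rm c}(\mathcal T)$ that represents the complete hyperbolic structure with geodesic boundary on $N$, when there is one. -/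

import Mathlib

open scoped ContDiff

noncomputable section

namespace TruncTri

/-! ## Combinatorial triangulations -/

/-- Combinatorial data of a gluing of oriented tetrahedra indexed by `T`.  Each tetrahedron has
vertices `0, 1, 2, 3`, listed in an order compatible with its orientation; its face `i` is the one
opposite to the vertex `i`.  The face `i` of `t` is glued to the face `glue t i i` of `adj t i`, by
the simplicial map sending a vertex `j ≠ i` to `glue t i j`.  The gluing maps reverse the
orientation (the permutations are odd), and no face is glued to itself. -/
structure FacePairing (T : Type*) where
  adj : T → Fin 4 → T
  glue : T → Fin 4 → Equiv.Perm (Fin 4)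
  adj_adj : ∀ t i, adj (adj t i) (glue t i i) = t
  glue_glue : ∀ t i, glue (adj t i) (glue t i i) = (glue t i)⁻¹
  sign_glue : ∀ t i, Equiv.Perm.sign (glue t i) = -1
  face_ne : ∀ t i, (adj t i, glue t i i) ≠ (t, i)

/-- The six edges of a tetrahedron. -/
abbrev TetEdge : Type := {e : Sym2 (Fin 4) // ¬ e.IsDiag}

/-- The directed edges of the tetrahedra: `(t, a, b)` is the edge of `t` from `a` to `b`. -/
abbrev DirEdge (T : Type*) : Type _ := {x : T × Fin 4 × Fin 4 // x.2.1 ≠ x.2.2}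

namespace FacePairing

variable {T : Type*} (P : FacePairing T)

/-- The face glued to a given face. -/
def pairedFace (F : T × Fin 4) : T × Fin 4 := (P.adj F.1 F.2, P.glue F.1 F.2 F.2)

/-- Vertices of tetrahedra that are identified by the gluing of one face. -/
def VertexStep (x y : T × Fin 4) : Prop :=
  ∃ i, i ≠ x.2 ∧ y = (P.adj x.1 i, P.glue x.1 i x.2)

/-- Directed edges of tetrahedra that are identified by the gluing of one face. -/
def DirEdgeStep (x y : DirEdge T) : Prop :=
  ∃ i, i ≠ x.1.2.1 ∧ i ≠ x.1.2.2 ∧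
    y.1 = (P.adj x.1.1 i, P.glue x.1.1 i x.1.2.1, P.glue x.1.1 i x.1.2.2)

/-- Edges of tetrahedra that are identified by the gluing of one face. -/
def EdgeStep (x y : T × TetEdge) : Prop :=
  ∃ i, i ∉ x.2.1 ∧ y.1 = P.adj x.1 i ∧ y.2.1 = Sym2.map (P.glue x.1 i) x.2.1

def vertexSetoid : Setoid (T × Fin 4) := Relation.EqvGen.setoid P.VertexStep

def dirEdgeSetoid : Setoid (DirEdge T) := Relation.EqvGen.setoid P.DirEdgeStep

def edgeSetoid : Setoid (T × TetEdge) := Relation.EqvGen.setoid P.EdgeStep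

/-- Vertices of the triangulation, i.e. boundary components of the compact manifold obtained by
truncating all the vertices. -/
abbrev Vertex : Type _ := Quotient P.vertexSetoid

/-- Edges of the triangulation. -/
abbrev Edge : Type _ := Quotient P.edgeSetoid

/-- Number of truncation triangles in the link of a vertex. -/
def linkTriangles (V : P.Vertex) : ℕ :=
  Nat.card {x : T × Fin 4 // Quotient.mk P.vertexSetoid x = V}

/-- Number of vertices in the link of a vertex `V`: the directed edges of the triangulation
that start at `V`. -/
def linkVertices (V : P.Vertex) : ℕ :=
  Nat.card {D : Quotient P.dirEdgeSetoid //
    ∃ x : DirEdge T, Quotient.mk P.dirEdgeSetoid x = D ∧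
      Quotient.mk P.vertexSetoid (x.1.1, x.1.2.1) = V}

/-- Euler characteristic (vertices minus edges plus triangles) of the link of a vertex.  The link
is a connected closed oriented triangulated surface, the sides of its triangles being glued in
pairs, so that it has `3 / 2` as many edges as triangles. -/
def linkEulerChar (V : P.Vertex) : ℤ :=
  (P.linkVertices V : ℤ) - (3 * (P.linkTriangles V : ℤ)) / 2 + (P.linkTriangles V : ℤ)

end FacePairing

/-- A partially truncated triangulation of an oriented 3-manifold `N`.  No edge is identified with
itself with reversed direction, so truncating all the vertices yields a triangulated compact
oriented manifold `N̄` (every vertex link is a closed oriented surface), and `N` is obtained by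
removing the boundary tori of `N̄`. -/
structure Triangulation (T : Type*) extends FacePairing T where
  edge_not_reversed : ∀ (t : T) (a b : Fin 4) (h : a ≠ b),
    ¬ toFacePairing.dirEdgeSetoid.r ⟨(t, a, b), h⟩ ⟨(t, b, a), h.symm⟩

/-! ## Geometry of a partially truncated tetrahedron -/

/-- The pair `(a, b)` such that `(i, v, a, b)` is an even permutation of `(0, 1, 2, 3)`
(for `i ≠ v`); equivalently, `(v, a, b)` is the positive cyclic order of the vertices of the
face opposite to `i`. -/
def rest : Fin 4 → Fin 4 → Fin 4 × Fin 4
  | 0, 1 => (2, 3) | 0, 2 => (3, 1) | 0, 3 => (1, 2)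
  | 1, 0 => (3, 2) | 1, 2 => (0, 3) | 1, 3 => (2, 0)
  | 2, 0 => (1, 3) | 2, 1 => (3, 0) | 2, 3 => (0, 1)
  | 3, 0 => (2, 1) | 3, 1 => (0, 2) | 3, 2 => (1, 0)
  | _, _ => (0, 0)

theorem rest_spec : ∀ i v : Fin 4, i ≠ v → ∃ π : Equiv.Perm (Fin 4),
    Equiv.Perm.sign π = 1 ∧ π 0 = i ∧ π 1 = v ∧ (π 2, π 3) = rest i v := by
  decide

/-- The dihedral angle along the edge with endpoints `a ≠ b`. -/
def ang (θ : TetEdge → ℝ) (a b : Fin 4) : ℝ :=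
  if h : a = b then 0 else θ ⟨s(a, b), fun h' => h (Sym2.mk_isDiag_iff.mp h')⟩

theorem ang_comm (θ : TetEdge → ℝ) (a b : Fin 4) : ang θ a b = ang θ b a := by
  unfold ang
  by_cases h : a = b
  · simp [h]
  · have h' : ¬ b = a := fun h' => h h'.symm
    simp only [h, h', dite_false]
    congr 1
    exact Subtype.ext Sym2.eq_swap

/-- The sum of the dihedral angles along the three edges emanating from `v`. -/
def angleSum (θ : TetEdge → ℝ) (v : Fin 4) : ℝ := ∑ w ∈ Finset.univ.erase v, ang θ v w

/-- With `v` and its three adjacent edges carrying the angles `α, β, γ`, this is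
`2 cos α cos β cos γ + cos² α + cos² β + cos² γ - 1`. -/
def dFun (θ : TetEdge → ℝ) (v : Fin 4) : ℝ :=
  2 * (∏ w ∈ Finset.univ.erase v, Real.cos (ang θ v w))
    + (∑ w ∈ Finset.univ.erase v, Real.cos (ang θ v w) ^ 2) - 1

/-- The numerator in the length formula for the edge `ab` of a tetrahedron with remaining
vertices `c, d`. -/
def cFun (θ : TetEdge → ℝ) (a b c d : Fin 4) : ℝ :=
  Real.cos (ang θ a b) *
      (Real.cos (ang θ a d) * Real.cos (ang θ b c) + Real.cos (ang θ a c) * Real.cos (ang θ b d))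
    + Real.cos (ang θ a c) * Real.cos (ang θ b c) + Real.cos (ang θ a d) * Real.cos (ang θ b d)
    + Real.cos (ang θ c d) * Real.sin (ang θ a b) ^ 2

/-- The length of the internal edge with endpoints `a ≠ b` (both non-ideal):
`cosh L = c / √(d(a) d(b))`. -/
def internalLength (θ : TetEdge → ℝ) (a b : Fin 4) : ℝ :=
  Real.arcosh (cFun θ a b (rest a b).1 (rest a b).2 / Real.sqrt (dFun θ a * dFun θ b))

theorem internalLength_comm (θ : TetEdge → ℝ) (a b : Fin 4) :
    internalLength θ a b = internalLength θ b a := by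
  have key : cFun θ a b (rest a b).1 (rest a b).2 = cFun θ b a (rest b a).1 (rest b a).2 := by
    have h : (rest b a).1 = (rest a b).2 ∧ (rest b a).2 = (rest a b).1 := by
      revert a b; decide
    rw [h.1, h.2]
    unfold cFun
    rw [ang_comm θ b a, ang_comm θ (rest a b).2 (rest a b).1]
    ring
  unfold internalLength
  rw [key, mul_comm (dFun θ a)]

/-- The length of an internal edge, as a function on unordered edges. -/
def edgeLength (θ : TetEdge → ℝ) (e : TetEdge) : ℝ :=
  Sym2.lift ⟨internalLength θ, internalLength_comm θ⟩ e.1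

/-- The length of the boundary edge at the non-ideal vertex `a` joining the internal edges `ax` and
`ay`, where `z` is the remaining vertex. -/
def boundaryLength (θ : TetEdge → ℝ) (a x y z : Fin 4) : ℝ :=
  Real.arcosh ((Real.cos (ang θ a x) * Real.cos (ang θ a y) + Real.cos (ang θ a z)) /
    (Real.sin (ang θ a x) * Real.sin (ang θ a y)))

/-- The invariant `σ` of the face opposite to `i` of a tetrahedron, when that face is exceptional
with ideal vertex `v ≠ i`: if `(v, a, b)` is the positive cyclic order of its vertices, this is the
logarithm of the ratio of the hyperbolic sines of the lengths of its boundary edges at `a`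
and `b`. -/
def sigmaAt (θ : TetEdge → ℝ) (i v : Fin 4) : ℝ :=
  Real.log (Real.sinh (boundaryLength θ (rest i v).1 v (rest i v).2 i) /
    Real.sinh (boundaryLength θ (rest i v).2 v (rest i v).1 i))

/-! ## Moduli space and consistency equations -/

namespace Triangulation

variable {T : Type*} (𝒯 : Triangulation T)

/-- A vertex of the triangulation is ideal if its link is a torus. -/
def IsIdealVertex (V : 𝒯.Vertex) : Prop := 𝒯.linkEulerChar V = 0

/-- The vertex `v` of the tetrahedron `t` is ideal. -/
def IsIdeal (t : T) (v : Fin 4) : Prop := 𝒯.IsIdealVertex (Quotient.mk 𝒯.vertexSetoid (t, v))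

/-- A triangulation is good if every tetrahedron has at most one ideal vertex. -/
def IsGood : Prop := ∀ t v w, 𝒯.IsIdeal t v → 𝒯.IsIdeal t w → v = w

/-- The boundary tori of `N̄`, i.e. the toric cusps of `N`. -/
abbrev Cusp : Type _ := {V : 𝒯.Vertex // 𝒯.IsIdealVertex V}

/-- The number `k` of toric cusps. -/
def numCusps : ℕ := Nat.card 𝒯.Cusp

/-- The number `p` of non-compact tetrahedra. -/
def numNoncompactTets : ℕ := Nat.card {t : T // ∃ v, 𝒯.IsIdeal t v}

/-- An edge of a tetrahedron is compact if it has no ideal endpoint. -/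
def IsCompactEdge (x : T × TetEdge) : Prop := ∀ v ∈ x.2.1, ¬ 𝒯.IsIdeal x.1 v

/-- The edges of the triangulation without ideal endpoints. -/
abbrev CompactEdge : Type _ :=
  {E : 𝒯.Edge // ∃ x, Quotient.mk 𝒯.edgeSetoid x = E ∧ 𝒯.IsCompactEdge x}

/-- The number `l` of edges of the triangulation without ideal endpoints. -/
def numCompactEdges : ℕ := Nat.card 𝒯.CompactEdge

/-- A lateral hexagon (face of a tetrahedron) is exceptional if it has an ideal vertex. -/
def IsExceptional (F : T × Fin 4) : Prop := ∃ v, v ≠ F.2 ∧ 𝒯.IsIdeal F.1 v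

/-- The moduli space `W ⊆ ℝ^{6t}` of geometric realizations of the tetrahedra, in terms of
dihedral angles. -/
def moduli : Set (T × TetEdge → ℝ) :=
  {x | (∀ t e, x (t, e) ∈ Set.Ioo 0 Real.pi) ∧
    ∀ t v, (𝒯.IsIdeal t v → angleSum (fun e => x (t, e)) v = Real.pi) ∧
      (¬ 𝒯.IsIdeal t v → angleSum (fun e => x (t, e)) v < Real.pi)}

/-- The tangent space to `W` at any of its points: the direction of the affine subspace of `ℝ^{6t}`
in which `W` is open. -/
def moduliTangent : Submodule ℝ (T × TetEdge → ℝ) where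
  carrier := {ξ | ∀ t v, 𝒯.IsIdeal t v → angleSum (fun e => ξ (t, e)) v = 0}
  add_mem' := by
    intro ξ η hξ hη t v h
    have h1 := hξ t v h
    have h2 := hη t v h
    have : angleSum (fun e => (ξ + η) (t, e)) v
        = angleSum (fun e => ξ (t, e)) v + angleSum (fun e => η (t, e)) v := by
      unfold angleSum
      rw [← Finset.sum_add_distrib]
      refine Finset.sum_congr rfl fun w _ => ?_
      unfold ang
      split_ifs <;> simp
    rw [this, h1, h2, add_zero]
  zero_mem' := by
    intro t v _
    unfold angleSum
    refine Finset.sum_eq_zero fun w _ => ?_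
    unfold ang
    split_ifs <;> simp
  smul_mem' := by
    intro c ξ hξ t v h
    have h1 := hξ t v h
    have : angleSum (fun e => (c • ξ) (t, e)) v = c * angleSum (fun e => ξ (t, e)) v := by
      unfold angleSum
      rw [Finset.mul_sum]
      refine Finset.sum_congr rfl fun w _ => ?_
      unfold ang
      split_ifs <;> simp
    rw [this, h1, mul_zero]

open Classical in
/-- The value of `σ` on an exceptional lateral hexagon. -/
def sigma (x : T × TetEdge → ℝ) (F : T × Fin 4) : ℝ :=
  if h : 𝒯.IsExceptional F then sigmaAt (fun e => x (F.1, e)) F.2 h.choose else 0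

/-- The choice of a non-redundant system of matching equations: for every compact edge of the
triangulation, one of the tetrahedral edges in its class, to which the lengths of the others are
compared; for every cusp, an exceptional hexagon incident to that cusp, whose `σ`-equation is
discarded. -/
structure EquationChoice where
  base : 𝒯.CompactEdge → T × TetEdge
  base_spec : ∀ E, Quotient.mk 𝒯.edgeSetoid (base E) = E.1
  drop : 𝒯.Cusp → T × Fin 4
  drop_spec : ∀ κ, ∃ v, v ≠ (drop κ).2 ∧ Quotient.mk 𝒯.vertexSetoid ((drop κ).1, v) = κ.1

namespace EquationChoice

variable {𝒯} (ch : 𝒯.EquationChoice)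

/-- The compact edges of tetrahedra other than the chosen representatives.  They index the
length equations. -/
abbrev LengthEq : Type _ := {x : T × TetEdge // 𝒯.IsCompactEdge x ∧ ∀ E, ch.base E ≠ x}

/-- The unordered pairs of matching exceptional hexagons other than the discarded ones.  They index
the `σ`-equations. -/
abbrev SigmaEq (ch : 𝒯.EquationChoice) : Type _ :=
  {q : Sym2 (T × Fin 4) // (∃ F, 𝒯.IsExceptional F ∧ q = s(F, 𝒯.pairedFace F)) ∧
    ∀ κ, q ≠ s(ch.drop κ, 𝒯.pairedFace (ch.drop κ))}

abbrev EqIndex : Type _ := ch.LengthEq ⊕ ch.SigmaEq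

instance [Finite T] : Fintype ch.LengthEq := Fintype.ofFinite _

instance [Finite T] : Fintype ch.SigmaEq := Fintype.ofFinite _

/-- The map `F`, given by the same formulas on all of `ℝ^{6t}`; it is meaningful on `W`.  Its
components are `L(e) - L(e')`, for `e` a compact edge of a tetrahedron and `e'` the chosen
representative of its class, and `σ(F) + σ(F')`, for `{F, F'}` a pair of matching exceptional
hexagons. -/
def matchingMap (x : T × TetEdge → ℝ) : ch.EqIndex → ℝ
  | Sum.inl y =>
      edgeLength (fun e => x (y.1.1, e)) y.1.2 -
        (let b := ch.base ⟨Quotient.mk 𝒯.edgeSetoid y.1, y.1, rfl, y.2.1⟩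
         edgeLength (fun e => x (b.1, e)) b.2)
  | Sum.inr q => Sym2.lift ⟨fun F F' => 𝒯.sigma x F + 𝒯.sigma x F', fun _ _ => add_comm _ _⟩ q.1

/-- The space `Ω_c = F⁻¹(0) ⊆ W` of cone structures. -/
def coneStructures : Set (T × TetEdge → ℝ) := {x | x ∈ 𝒯.moduli ∧ ch.matchingMap x = 0}

end EquationChoice

end Triangulation

/-- Near its point `x₀`, the set `S` is a smooth (embedded) submanifold of dimension `n` of
the normed space `E`: some smooth chart of `E` around `x₀` carries `S` to the slice
`ℝⁿ × {0}` of `ℝⁿ × ℝ^q`. -/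
def IsSmoothManifoldNear {E : Type*} [NormedAddCommGroup E] [NormedSpace ℝ E]
    (S : Set E) (n : ℕ) (x₀ : E) : Prop :=
  x₀ ∈ S ∧ ∃ (q : ℕ) (φ : OpenPartialHomeomorph E ((Fin n → ℝ) × (Fin q → ℝ))),
    x₀ ∈ φ.source ∧ ContDiffOn ℝ ∞ φ φ.source ∧ ContDiffOn ℝ ∞ φ.symm φ.target ∧
      ∀ x ∈ φ.source, x ∈ S ↔ (φ x).2 = 0

end TruncTri

end

open scoped ContDiff

noncomputable section

namespace TruncTri

open Filter Topology

/-! The heart is a rigidity statement for one tetrahedron (`IsGeometric.eq_zero_of_fderiv_eq_zero`):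
a tangent vector along which all compact edge lengths and all `σ` are stationary is zero. Three
internal lengths of a right-angled hexagon determine its boundary sides; a hexagon with an ideal
vertex is determined by its one compact internal edge and the ratio of sinh's encoded by `σ`; the
boundary sides form the truncation triangles, whose angles are the dihedral angles. Each
determination is an explicit inverse formula, so vanishing of derivatives along a line passes from
lengths to angles.

A dimension count turns injectivity into a description of the image. Without ideal vertices, six
lengths are coordinates on a 6-dimensional space. With one, three lengths and three `σ` whose sum is
identically zero match the dimension 5, so that relation is the only constraint
(`IsGeometric.exists_fderiv_eq`).

It remains to solve a linear problem on the gluing. Length equations are solved by perturbing only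
edges that are not representatives. For `σ` one needs face values with prescribed sums on the
retained pairs and zero sum on each noncompact tetrahedron (`faceSums_surjective`). A functional
obstructing this is constant on the tetrahedra around a cusp, and the discarded pair forces that
constant to vanish.

The dimension comes from counting faces and edges. The manifold statement follows from the inverse
function theorem, applied on an open set of `ℝ^{6t}` after adjoining the angle sum equations at the
ideal vertices. -/

/-! ### Functions with vanishing derivative at the origin -/

/-- The derivative of `f` at `0` exists and vanishes. -/
def Stationary (f : ℝ → ℝ) : Prop := HasDerivAt f 0 0

namespace Stationary

variable {f g : ℝ → ℝ}

theorem const (c : ℝ) : Stationary fun _ => c := hasDerivAt_const _ _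

theorem add (hf : Stationary f) (hg : Stationary g) : Stationary fun s => f s + g s := by
  show HasDerivAt _ _ _
  simpa using HasDerivAt.fun_add hf hg

theorem sub (hf : Stationary f) (hg : Stationary g) : Stationary fun s => f s - g s := by
  show HasDerivAt _ _ _
  simpa using HasDerivAt.fun_sub hf hg

theorem mul (hf : Stationary f) (hg : Stationary g) : Stationary fun s => f s * g s := by
  show HasDerivAt _ _ _
  simpa using HasDerivAt.fun_mul hf hg

theorem div (hf : Stationary f) (hg : Stationary g) (h0 : g 0 ≠ 0) :
    Stationary fun s => f s / g s := by
  show HasDerivAt _ _ _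
  simpa using HasDerivAt.fun_div hf hg h0

theorem comp {φ : ℝ → ℝ} (hφ : DifferentiableAt ℝ φ (f 0)) (hf : Stationary f) :
    Stationary fun s => φ (f s) := by
  show HasDerivAt _ _ _
  simpa [Function.comp_def] using HasDerivAt.comp (0 : ℝ) hφ.hasDerivAt hf

theorem sqrt (hf : Stationary f) (h0 : f 0 ≠ 0) : Stationary fun s => √(f s) :=
  comp (φ := Real.sqrt) (Real.hasDerivAt_sqrt h0).differentiableAt hf

theorem congr (hf : Stationary f) (h : ∀ᶠ s in 𝓝 0, g s = f s) : Stationary g :=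
  HasDerivAt.congr_of_eventuallyEq hf h

end Stationary

/-! ### Right-angled hexagons and pentagons, and triangles -/

/-- The hyperbolic cosine of a side of a right-angled hyperbolic hexagon, in terms of the
hyperbolic cosines `x`, `y` of the adjacent sides and `z` of the opposite side, these three being
pairwise non-adjacent. -/
def hexSide (x y z : ℝ) : ℝ := (x * y + z) / (√(x ^ 2 - 1) * √(y ^ 2 - 1))

theorem sq_sub_one_pos {x : ℝ} (hx : 1 < x) : 0 < x ^ 2 - 1 := by nlinarith

/-- The numerator is symmetric in `x`, `y`, `z`, so it cancels when the hexagon formula is applied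
twice. -/
theorem hexSide_sq_sub_one {x y z : ℝ} (hx : 1 < x) (hy : 1 < y) :
    hexSide x y z ^ 2 - 1 = (x ^ 2 + y ^ 2 + z ^ 2 + 2 * x * y * z - 1) /
      (√(x ^ 2 - 1) * √(y ^ 2 - 1)) ^ 2 := by
  have h1 := Real.sqrt_pos.2 (sq_sub_one_pos hx)
  have h2 := Real.sqrt_pos.2 (sq_sub_one_pos hy)
  have h3 := Real.sq_sqrt (sq_sub_one_pos hx).le
  have h4 := Real.sq_sqrt (sq_sub_one_pos hy).le
  unfold hexSide
  rw [div_pow, div_sub_one (by positivity), mul_pow, h3, h4]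
  congr 1
  ring

/-- Only `0 < z` is required, so that `z = 1`, the case of an ideal opposite vertex, is covered. -/
theorem one_lt_hexSide {x y z : ℝ} (hx : 1 < x) (hy : 1 < y) (hz : 0 < z) :
    1 < hexSide x y z := by
  have h1 := Real.sqrt_pos.2 (sq_sub_one_pos hx)
  have h2 := Real.sqrt_pos.2 (sq_sub_one_pos hy)
  have h3 := Real.sq_sqrt (sq_sub_one_pos hx).le
  have h4 := Real.sq_sqrt (sq_sub_one_pos hy).le
  unfold hexSide
  rw [one_lt_div (by positivity)]
  have h5 : √(x ^ 2 - 1) < x := by nlinarith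
  have h6 : √(y ^ 2 - 1) < y := by nlinarith
  nlinarith [mul_lt_mul'' h5 h6 h1.le h2.le]

/-- The two alternating triples of sides of a right-angled hexagon play the same role, so the law of
cosines is an involution. -/
theorem hexagon_inverse {x y z : ℝ} (hx : 1 < x) (hy : 1 < y) (hz : 1 < z) :
    hexSide (hexSide x y z) (hexSide x z y) (hexSide y z x) = x := by
  have h1 := Real.sqrt_pos.2 (sq_sub_one_pos hx)
  have h2 := Real.sqrt_pos.2 (sq_sub_one_pos hy)
  have h3 := Real.sqrt_pos.2 (sq_sub_one_pos hz)
  have h4 := Real.sq_sqrt (sq_sub_one_pos hx).le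
  have hD : 0 < x ^ 2 + y ^ 2 + z ^ 2 + 2 * x * y * z - 1 := by
    have : 0 < x * y * z := by positivity
    nlinarith
  have e1 := hexSide_sq_sub_one (z := z) hx hy
  have e2 := hexSide_sq_sub_one (z := y) hx hz
  rw [show x ^ 2 + z ^ 2 + y ^ 2 + 2 * x * z * y - 1 =
    x ^ 2 + y ^ 2 + z ^ 2 + 2 * x * y * z - 1 by ring] at e2
  rw [hexSide, e1, e2, Real.sqrt_div hD.le, Real.sqrt_div hD.le, Real.sqrt_sq (by positivity),
    Real.sqrt_sq (by positivity), div_mul_div_comm, Real.mul_self_sqrt hD.le]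
  unfold hexSide
  generalize √(x ^ 2 - 1) = u at *
  generalize √(y ^ 2 - 1) = v at *
  generalize √(z ^ 2 - 1) = w at *
  have hn : (x * y + z) / (u * v) * ((x * z + y) / (u * w)) + (y * z + x) / (v * w)
      = x * (x ^ 2 + y ^ 2 + z ^ 2 + 2 * x * y * z - 1) / (u * v * (u * w)) := by
    field_simp
    rw [h4]
    ring
  rw [hn, div_div_div_cancel_right₀ (by positivity), mul_div_assoc, div_self hD.ne', mul_one]

/-- Here `z = 1`, as the opposite side degenerates to an ideal vertex. With `r` the ratio of the
sinh's and `K` the cosh of the internal side, `r (r + 1/r + 2K) = (x + y)² / (y² - 1)`, while `K² -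
1 = (x + y)² / ((x² - 1)(y² - 1))`; the quotient is `x² - 1`. -/
theorem pentagon_inverse {x y : ℝ} (hx : 1 < x) (hy : 1 < y) :
    √(1 + √(x ^ 2 - 1) / √(y ^ 2 - 1) * (√(x ^ 2 - 1) / √(y ^ 2 - 1)
      + 1 / (√(x ^ 2 - 1) / √(y ^ 2 - 1)) + 2 * hexSide x y 1) / (hexSide x y 1 ^ 2 - 1)) = x := by
  have h1 := Real.sqrt_pos.2 (sq_sub_one_pos hx)
  have h2 := Real.sqrt_pos.2 (sq_sub_one_pos hy)
  have h4 := Real.sq_sqrt (sq_sub_one_pos hx).le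
  have h5 := Real.sq_sqrt (sq_sub_one_pos hy).le
  rw [hexSide_sq_sub_one hx hy]
  unfold hexSide
  rw [show x ^ 2 + y ^ 2 + 1 ^ 2 + 2 * x * y * 1 - 1 = (x + y) ^ 2 by ring]
  generalize √(x ^ 2 - 1) = u at *
  generalize √(y ^ 2 - 1) = v at *
  have hxy : 0 < x + y := by linarith
  have : u / v * (u / v + 1 / (u / v) + 2 * ((x * y + 1) / (u * v))) / ((x + y) ^ 2 / (u * v) ^ 2)
      = u ^ 2 := by
    have : u / v * (u / v + 1 / (u / v) + 2 * ((x * y + 1) / (u * v))) = (x + y) ^ 2 / v ^ 2 := by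
      field_simp
      rw [h4, h5]; ring
    rw [this]
    field_simp
  rw [this, h4]
  rw [show 1 + (x ^ 2 - 1) = x ^ 2 by ring, Real.sqrt_sq (by linarith)]

theorem Stationary.hexSide {f g h : ℝ → ℝ} (hf : Stationary f) (hg : Stationary g)
    (hh : Stationary h) (hf1 : 1 < f 0) (hg1 : 1 < g 0) :
    Stationary fun s => hexSide (f s) (g s) (h s) := by
  have h1 := sq_sub_one_pos hf1
  have h2 := sq_sub_one_pos hg1
  have h3 := Real.sqrt_pos.2 h1
  have h4 := Real.sqrt_pos.2 h2
  unfold TruncTri.hexSide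
  refine ((hf.mul hg).add hh).div (Stationary.mul (Stationary.sqrt ?_ h1.ne')
    (Stationary.sqrt ?_ h2.ne')) (by positivity)
  · exact (Stationary.comp (φ := fun x => x ^ 2) (by fun_prop) hf).sub (.const 1)
  · exact (Stationary.comp (φ := fun x => x ^ 2) (by fun_prop) hg).sub (.const 1)

theorem stationary_of_hexagon {x y z : ℝ → ℝ} (hx : ∀ᶠ s in 𝓝 0, 1 < x s)
    (hy : ∀ᶠ s in 𝓝 0, 1 < y s) (hz : ∀ᶠ s in 𝓝 0, 1 < z s)
    (hxy : Stationary fun s => hexSide (x s) (y s) (z s))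
    (hxz : Stationary fun s => hexSide (x s) (z s) (y s))
    (hyz : Stationary fun s => hexSide (y s) (z s) (x s)) : Stationary x := by
  have x0 := hx.self_of_nhds
  have y0 := hy.self_of_nhds
  have z0 := hz.self_of_nhds
  refine (hxy.hexSide hxz hyz (one_lt_hexSide x0 y0 (by linarith))
    (one_lt_hexSide x0 z0 (by linarith))).congr ?_
  filter_upwards [hx, hy, hz] with s h1 h2 h3
  exact (hexagon_inverse h1 h2 h3).symm

theorem stationary_of_pentagon {x y : ℝ → ℝ} (hx : ∀ᶠ s in 𝓝 0, 1 < x s)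
    (hy : ∀ᶠ s in 𝓝 0, 1 < y s) (hxy : Stationary fun s => hexSide (x s) (y s) 1)
    (hr : Stationary fun s => √(x s ^ 2 - 1) / √(y s ^ 2 - 1)) : Stationary x := by
  have x0 := hx.self_of_nhds
  have y0 := hy.self_of_nhds
  have h1 := Real.sqrt_pos.2 (sq_sub_one_pos x0)
  have h2 := Real.sqrt_pos.2 (sq_sub_one_pos y0)
  have hK := one_lt_hexSide x0 y0 one_pos
  have key : Stationary fun s => √(1 + √(x s ^ 2 - 1) / √(y s ^ 2 - 1) *
      (√(x s ^ 2 - 1) / √(y s ^ 2 - 1) + 1 / (√(x s ^ 2 - 1) / √(y s ^ 2 - 1))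
        + 2 * hexSide (x s) (y s) 1) / (hexSide (x s) (y s) 1 ^ 2 - 1)) := by
    have hs := sq_sub_one_pos hK
    refine Stationary.sqrt (Stationary.add (.const 1) (Stationary.div (hr.mul ((hr.add
      (Stationary.div (.const 1) hr (by positivity))).add ((Stationary.const 2).mul hxy)))
      ((Stationary.comp (φ := fun x => x ^ 2) (by fun_prop) hxy).sub (.const 1)) hs.ne')) ?_
    have : 0 < hexSide (x 0) (y 0) 1 := by linarith
    positivity
  refine key.congr ?_
  filter_upwards [hx, hy] with s h1 h2
  exact (pentagon_inverse h1 h2).symm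

/-- The hyperbolic cosine of the side between the angles `α` and `β` of a hyperbolic triangle with
third angle `γ`. -/
def triSide (α β γ : ℝ) : ℝ :=
  (Real.cos α * Real.cos β + Real.cos γ) / (Real.sin α * Real.sin β)

theorem triSide_comm (α β γ : ℝ) : triSide α β γ = triSide β α γ := by
  unfold triSide; rw [mul_comm (Real.cos α), mul_comm (Real.sin α)]

/-- Up to the sign, the determinant of the Gram matrix of a hyperbolic triangle. -/
def triGram (α β γ : ℝ) : ℝ :=
  2 * (Real.cos α * Real.cos β * Real.cos γ)
    + (Real.cos α ^ 2 + Real.cos β ^ 2 + Real.cos γ ^ 2) - 1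

theorem sin_mul_sin_lt {α β γ : ℝ} (hα : 0 < α) (hβ : 0 < β) (hγ : 0 < γ)
    (h : α + β + γ < Real.pi) :
    Real.sin α * Real.sin β < Real.cos α * Real.cos β + Real.cos γ := by
  have h1 : Real.cos (Real.pi - (α + β)) < Real.cos γ :=
    Real.cos_lt_cos_of_nonneg_of_le_pi hγ.le (by linarith) (by linarith)
  rw [Real.cos_pi_sub, Real.cos_add] at h1
  linarith

theorem triSide_eq_one {α β γ : ℝ} (hα : 0 < α) (hβ : 0 < β) (hγ : 0 < γ)
    (h : α + β + γ = Real.pi) : triSide α β γ = 1 := by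
  have h1 := Real.sin_pos_of_pos_of_lt_pi hα (by linarith)
  have h2 := Real.sin_pos_of_pos_of_lt_pi hβ (by linarith)
  have : γ = Real.pi - (α + β) := by linarith
  unfold triSide
  rw [this, Real.cos_pi_sub, Real.cos_add, div_eq_one_iff_eq (by positivity)]
  ring

theorem one_lt_triSide {α β γ : ℝ} (hα : 0 < α) (hβ : 0 < β) (hγ : 0 < γ)
    (h : α + β + γ < Real.pi) : 1 < triSide α β γ := by
  have h1 := Real.sin_pos_of_pos_of_lt_pi hα (by linarith)
  have h2 := Real.sin_pos_of_pos_of_lt_pi hβ (by linarith)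
  unfold triSide
  rw [one_lt_div (by positivity)]
  exact sin_mul_sin_lt hα hβ hγ h

/-- The Gram determinant is symmetric in the three angles, which is the sine rule. It cancels in
`triangle_inverse` and makes sinh of a side split into factors attached to a vertex and to edges. -/
theorem triSide_sq_sub_one {α β : ℝ} (γ : ℝ) (h1 : Real.sin α ≠ 0) (h2 : Real.sin β ≠ 0) :
    triSide α β γ ^ 2 - 1 = triGram α β γ / (Real.sin α * Real.sin β) ^ 2 := by
  unfold triSide triGram
  rw [div_pow, div_sub_one (by positivity)]
  congr 1
  rw [mul_pow, Real.sin_sq, Real.sin_sq]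
  ring

theorem triGram_pos {α β γ : ℝ} (hα : 0 < α) (hβ : 0 < β) (hγ : 0 < γ)
    (h : α + β + γ < Real.pi) : 0 < triGram α β γ := by
  have h1 := Real.sin_pos_of_pos_of_lt_pi hα (by linarith)
  have h2 := Real.sin_pos_of_pos_of_lt_pi hβ (by linarith)
  have h3 := sq_sub_one_pos (one_lt_triSide hα hβ hγ h)
  rw [triSide_sq_sub_one γ h1.ne' h2.ne'] at h3
  exact (div_pos_iff_of_pos_right (by positivity)).1 h3

theorem sqrt_triSide_sq_sub_one {α β γ : ℝ} (hα : 0 < α) (hβ : 0 < β) (hγ : 0 < γ)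
    (h : α + β + γ < Real.pi) :
    √(triSide α β γ ^ 2 - 1) = √(triGram α β γ) / (Real.sin α * Real.sin β) := by
  have h1 := Real.sin_pos_of_pos_of_lt_pi hα (by linarith)
  have h2 := Real.sin_pos_of_pos_of_lt_pi hβ (by linarith)
  rw [triSide_sq_sub_one γ h1.ne' h2.ne', Real.sqrt_div (triGram_pos hα hβ hγ h).le,
    Real.sqrt_sq (by positivity)]

/-- The law of cosines for sides: the three sides of a hyperbolic triangle recover its angles. -/
theorem triangle_inverse {α β γ : ℝ} (hα : 0 < α) (hβ : 0 < β) (hγ : 0 < γ)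
    (h : α + β + γ < Real.pi) :
    (triSide α β γ * triSide α γ β - triSide β γ α) /
      (√(triSide α β γ ^ 2 - 1) * √(triSide α γ β ^ 2 - 1)) = Real.cos α := by
  have h1 := Real.sin_pos_of_pos_of_lt_pi hα (by linarith)
  have h2 := Real.sin_pos_of_pos_of_lt_pi hβ (by linarith)
  have h3 := Real.sin_pos_of_pos_of_lt_pi hγ (by linarith)
  have hG := triGram_pos hα hβ hγ h
  have e : triGram α γ β = triGram α β γ := by unfold triGram; ring
  rw [sqrt_triSide_sq_sub_one hα hβ hγ h, sqrt_triSide_sq_sub_one hα hγ hβ (by linarith), e,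
    div_mul_div_comm, Real.mul_self_sqrt hG.le]
  have hs := Real.sin_sq α
  have hn : triSide α β γ * triSide α γ β - triSide β γ α = Real.cos α * triGram α β γ /
      (Real.sin α * Real.sin β * (Real.sin α * Real.sin γ)) := by
    unfold triSide triGram
    generalize Real.sin α = u at *
    field_simp
    rw [hs]
    ring
  rw [hn, div_div_div_cancel_right₀ (by positivity), mul_div_assoc, div_self hG.ne', mul_one]

theorem stationary_cos_of_triangle {α β γ : ℝ → ℝ} (hα : ∀ᶠ s in 𝓝 0, 0 < α s)
    (hβ : ∀ᶠ s in 𝓝 0, 0 < β s) (hγ : ∀ᶠ s in 𝓝 0, 0 < γ s)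
    (h : ∀ᶠ s in 𝓝 0, α s + β s + γ s < Real.pi)
    (h1 : Stationary fun s => triSide (α s) (β s) (γ s))
    (h2 : Stationary fun s => triSide (α s) (γ s) (β s))
    (h3 : Stationary fun s => triSide (β s) (γ s) (α s)) :
    Stationary fun s => Real.cos (α s) := by
  have α0 := hα.self_of_nhds
  have β0 := hβ.self_of_nhds
  have γ0 := hγ.self_of_nhds
  have h0 := h.self_of_nhds
  have p1 := sq_sub_one_pos (one_lt_triSide α0 β0 γ0 h0)
  have p2 := sq_sub_one_pos (one_lt_triSide α0 γ0 β0 (by linarith))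
  have q1 := Real.sqrt_pos.2 p1
  have q2 := Real.sqrt_pos.2 p2
  have t1 := (Stationary.comp (φ := fun x => x ^ 2) (by fun_prop) h1).sub (.const 1)
  have t2 := (Stationary.comp (φ := fun x => x ^ 2) (by fun_prop) h2).sub (.const 1)
  refine (((h1.mul h2).sub h3).div ((t1.sqrt p1.ne').mul (t2.sqrt p2.ne'))
    (by positivity)).congr ?_
  filter_upwards [hα, hβ, hγ, h] with s a1 a2 a3 a4
  exact (triangle_inverse a1 a2 a3 a4).symm

/-! ### Geometry of a single tetrahedron -/

/-- Four vertices of a tetrahedron, pairwise different. -/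
def AllDistinct (a b c d : Fin 4) : Prop := a ≠ b ∧ a ≠ c ∧ a ≠ d ∧ b ≠ c ∧ b ≠ d ∧ c ≠ d

instance (a b c d : Fin 4) : Decidable (AllDistinct a b c d) := by
  unfold AllDistinct; infer_instance

theorem erase_eq : ∀ a b c d : Fin 4, AllDistinct a b c d →
    Finset.univ.erase a = {b, c, d} := by decide

theorem rest_eq : ∀ a b c d : Fin 4, AllDistinct a b c d →
    rest a b = (c, d) ∨ rest a b = (d, c) := by decide

theorem rest_distinct : ∀ a b : Fin 4, a ≠ b →
    AllDistinct a b (rest a b).1 (rest a b).2 := by decide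

theorem exists_allDistinct : ∀ a b : Fin 4, a ≠ b → ∃ c d, AllDistinct a b c d := by decide

section

variable {θ : TetEdge → ℝ} {a b c d : Fin 4}

theorem angleSum_eq (h : AllDistinct a b c d) (θ : TetEdge → ℝ) :
    angleSum θ a = ang θ a b + ang θ a c + ang θ a d := by
  unfold angleSum
  obtain ⟨-, -, -, h1, h2, h3⟩ := id h
  rw [erase_eq a b c d h, Finset.sum_insert (by simp [h1, h2]), Finset.sum_pair h3, add_assoc]

theorem dFun_eq (h : AllDistinct a b c d) (θ : TetEdge → ℝ) :
    dFun θ a = triGram (ang θ a b) (ang θ a c) (ang θ a d) := by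
  unfold dFun triGram
  obtain ⟨-, -, -, h1, h2, h3⟩ := id h
  rw [erase_eq a b c d h, Finset.sum_insert (by simp [h1, h2]), Finset.sum_pair h3,
    Finset.prod_insert (by simp [h1, h2]), Finset.prod_pair h3]
  ring

theorem cFun_comm (θ : TetEdge → ℝ) (a b c d : Fin 4) : cFun θ a b c d = cFun θ a b d c := by
  unfold cFun
  rw [ang_comm θ d c]
  ring

end

/-- The hyperbolic cosine of the length of the internal edge `ab`, as given by the angles. -/
def coshLength (θ : TetEdge → ℝ) (a b : Fin 4) : ℝ :=
  cFun θ a b (rest a b).1 (rest a b).2 / Real.sqrt (dFun θ a * dFun θ b)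

theorem coshLength_eq {a b c d : Fin 4} (h : AllDistinct a b c d) (θ : TetEdge → ℝ) :
    coshLength θ a b = cFun θ a b c d / Real.sqrt (dFun θ a * dFun θ b) := by
  unfold coshLength
  rcases rest_eq a b c d h with e | e <;> rw [e]
  rw [cFun_comm]

/-- The hyperbolic cosine of the length of the boundary edge at `a` between the internal edges `ax`
and `ay`, where `z` is the remaining vertex. -/
def coshBdry (θ : TetEdge → ℝ) (a x y z : Fin 4) : ℝ :=
  triSide (ang θ a x) (ang θ a y) (ang θ a z)

theorem boundaryLength_eq (θ : TetEdge → ℝ) (a x y z : Fin 4) :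
    boundaryLength θ a x y z = Real.arcosh (coshBdry θ a x y z) := rfl

/-- The angles `θ` are those of a geometric tetrahedron whose set of ideal vertices is `I`. -/
structure IsGeometric (I : Fin 4 → Prop) (θ : TetEdge → ℝ) : Prop where
  mem_Ioo : ∀ a b, a ≠ b → ang θ a b ∈ Set.Ioo 0 Real.pi
  ideal : ∀ v, I v → angleSum θ v = Real.pi
  nonideal : ∀ v, ¬ I v → angleSum θ v < Real.pi

/-- Open conditions on the angles which make the lengths of the internal edges without endpoints
in `I`, and the invariants `σ`, well defined. -/
structure IsAdmissible (I : Fin 4 → Prop) (θ : TetEdge → ℝ) : Prop where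
  mem_Ioo : ∀ a b, a ≠ b → ang θ a b ∈ Set.Ioo 0 Real.pi
  nonideal : ∀ v, ¬ I v → angleSum θ v < Real.pi
  sqrt_lt : ∀ a b, a ≠ b → ¬ I a → ¬ I b →
    √(dFun θ a * dFun θ b) < cFun θ a b (rest a b).1 (rest a b).2

namespace IsAdmissible

variable {I : Fin 4 → Prop} {θ : TetEdge → ℝ} {a b c d : Fin 4}

theorem sin_pos (hθ : IsAdmissible I θ) (h : a ≠ b) : 0 < Real.sin (ang θ a b) :=
  Real.sin_pos_of_mem_Ioo (hθ.mem_Ioo a b h)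

theorem dFun_pos (hθ : IsAdmissible I θ) (ha : ¬ I a) : 0 < dFun θ a := by
  obtain ⟨b, hb⟩ := exists_ne a
  obtain ⟨c, d, h⟩ := exists_allDistinct a b hb.symm
  have hs := hθ.nonideal a ha
  rw [angleSum_eq h] at hs
  rw [dFun_eq h]
  exact triGram_pos (hθ.mem_Ioo a b h.1).1 (hθ.mem_Ioo a c h.2.1).1 (hθ.mem_Ioo a d h.2.2.1).1 hs

theorem one_lt_coshBdry (hθ : IsAdmissible I θ) (h : AllDistinct a b c d) (ha : ¬ I a) :
    1 < coshBdry θ a b c d := by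
  have hs := hθ.nonideal a ha
  rw [angleSum_eq h] at hs
  exact one_lt_triSide (hθ.mem_Ioo a b h.1).1 (hθ.mem_Ioo a c h.2.1).1
    (hθ.mem_Ioo a d h.2.2.1).1 hs

theorem sqrt_coshBdry (hθ : IsAdmissible I θ) (h : AllDistinct a b c d) (ha : ¬ I a) :
    √(coshBdry θ a b c d ^ 2 - 1) =
      √(dFun θ a) / (Real.sin (ang θ a b) * Real.sin (ang θ a c)) := by
  have hs := hθ.nonideal a ha
  rw [angleSum_eq h] at hs
  rw [dFun_eq h]
  exact sqrt_triSide_sq_sub_one (hθ.mem_Ioo a b h.1).1 (hθ.mem_Ioo a c h.2.1).1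
    (hθ.mem_Ioo a d h.2.2.1).1 hs

theorem one_lt_coshLength (hθ : IsAdmissible I θ) (h : a ≠ b) (ha : ¬ I a) (hb : ¬ I b) :
    1 < coshLength θ a b := by
  have h1 := hθ.dFun_pos ha
  have h2 := hθ.dFun_pos hb
  unfold coshLength
  rw [one_lt_div (by positivity)]
  exact hθ.sqrt_lt a b h ha hb

theorem sinh_boundaryLength (hθ : IsAdmissible I θ) (h : AllDistinct a b c d) (ha : ¬ I a) :
    Real.sinh (boundaryLength θ a b c d) =
      √(dFun θ a) / (Real.sin (ang θ a b) * Real.sin (ang θ a c)) := by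
  rw [boundaryLength_eq, Real.sinh_arcosh (hθ.one_lt_coshBdry h ha).le, hθ.sqrt_coshBdry h ha]

theorem sinh_boundaryLength_pos (hθ : IsAdmissible I θ) (h : AllDistinct a b c d) (ha : ¬ I a) :
    0 < Real.sinh (boundaryLength θ a b c d) := by
  have h1 := hθ.dFun_pos ha
  have h2 := hθ.sin_pos h.1
  have h3 := hθ.sin_pos h.2.1
  rw [hθ.sinh_boundaryLength h ha]
  positivity

end IsAdmissible

/-- In the right-angled hexagon `abc`, the length of the internal edge `ab` is determined by the
boundary edges. -/
theorem coshLength_eq_hexSide {I : Fin 4 → Prop} {θ : TetEdge → ℝ} {a b c d : Fin 4}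
    (hI : ∀ x y, x ≠ y → ang θ x y ∈ Set.Ioo 0 Real.pi)
    (hs : ∀ v, ¬ I v → angleSum θ v < Real.pi)
    (h : AllDistinct a b c d) (ha : ¬ I a) (hb : ¬ I b) :
    coshLength θ a b = hexSide (coshBdry θ a b c d) (coshBdry θ b a c d) (coshBdry θ c a b d) := by
  obtain ⟨hab, hac, had, hbc, hbd, hcd⟩ := id h
  have h' : AllDistinct b a c d := ⟨hab.symm, hbc, hbd, hac, had, hcd⟩
  have sab := Real.sin_pos_of_mem_Ioo (hI a b hab)
  have sac := Real.sin_pos_of_mem_Ioo (hI a c hac)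
  have sbc := Real.sin_pos_of_mem_Ioo (hI b c hbc)
  have hsa := hs a ha
  have hsb := hs b hb
  rw [angleSum_eq h] at hsa
  rw [angleSum_eq h'] at hsb
  have pa := triGram_pos (hI a b hab).1 (hI a c hac).1 (hI a d had).1 hsa
  have pb := triGram_pos (hI b a hab.symm).1 (hI b c hbc).1 (hI b d hbd).1 hsb
  rw [coshLength_eq h, hexSide, coshBdry, coshBdry,
    sqrt_triSide_sq_sub_one (hI a b hab).1 (hI a c hac).1 (hI a d had).1 hsa,
    sqrt_triSide_sq_sub_one (hI b a hab.symm).1 (hI b c hbc).1 (hI b d hbd).1 hsb,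
    dFun_eq h, dFun_eq h', Real.sqrt_mul pa.le]
  have qa := Real.sqrt_pos.2 pa
  have qb := Real.sqrt_pos.2 pb
  generalize √(triGram (ang θ a b) (ang θ a c) (ang θ a d)) = u at *
  generalize √(triGram (ang θ b a) (ang θ b c) (ang θ b d)) = v at *
  unfold coshBdry triSide cFun
  rw [ang_comm θ b a, ang_comm θ c a, ang_comm θ c b]
  -- After clearing denominators only the square of the sine at the common edge `ab` survives; it is
  -- rewritten through the cosine to match `cFun`.
  have e := Real.sin_sq (ang θ a b)
  generalize Real.sin (ang θ a b) = x at *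
  field_simp
  rw [e]
  ring

/-- The square root inequality says that the cosh of the length exceeds 1. By the hexagon formula
this only needs the boundary side at the third vertex `c` to have positive cosh, which is 1 if `c`
is ideal and larger than 1 otherwise. -/
theorem IsGeometric.isAdmissible {I : Fin 4 → Prop} {θ : TetEdge → ℝ} (hθ : IsGeometric I θ) :
    IsAdmissible I θ where
  mem_Ioo := hθ.mem_Ioo
  nonideal := hθ.nonideal
  sqrt_lt := by
    intro a b hab ha hb
    have h := rest_distinct a b hab
    have hhex := coshLength_eq_hexSide hθ.mem_Ioo hθ.nonideal h ha hb
    generalize (rest a b).1 = c at *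
    generalize (rest a b).2 = d at *
    obtain ⟨-, hac, had, hbc, hbd, hcd⟩ := id h
    have h' : AllDistinct b a c d := ⟨hab.symm, hbc, hbd, hac, had, hcd⟩
    have h'' : AllDistinct c a b d := ⟨hac.symm, hbc.symm, hcd, hab, had, hbd⟩
    have hsa := hθ.nonideal a ha
    have hsb := hθ.nonideal b hb
    rw [angleSum_eq h] at hsa
    rw [angleSum_eq h'] at hsb
    have p (x y) (hxy : x ≠ y) := (hθ.mem_Ioo x y hxy).1
    have hc : 0 < coshBdry θ c a b d := by
      by_cases hc : I c
      · have hsc := hθ.ideal c hc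
        rw [angleSum_eq h''] at hsc
        rw [coshBdry, triSide_eq_one (p c a hac.symm) (p c b hbc.symm) (p c d hcd) hsc]
        exact one_pos
      · have hsc := hθ.nonideal c hc
        rw [angleSum_eq h''] at hsc
        exact one_pos.trans (one_lt_triSide (p c a hac.symm) (p c b hbc.symm) (p c d hcd) hsc)
    have h1 := one_lt_hexSide (one_lt_triSide (p a b hab) (p a c hac) (p a d had) hsa)
      (one_lt_triSide (p b a hab.symm) (p b c hbc) (p b d hbd) hsb) hc
    have pa := triGram_pos (p a b hab) (p a c hac) (p a d had) hsa
    have pb := triGram_pos (p b a hab.symm) (p b c hbc) (p b d hbd) hsb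
    rw [← dFun_eq h] at pa
    rw [← dFun_eq h'] at pb
    have h2 : 1 < coshLength θ a b := hhex ▸ h1
    rwa [coshLength_eq h, one_lt_div (by positivity)] at h2

theorem IsGeometric.coshBdry_eq_one {I : Fin 4 → Prop} {θ : TetEdge → ℝ} {a b c d : Fin 4}
    (hθ : IsGeometric I θ) (h : AllDistinct a b c d) (ha : I a) : coshBdry θ a b c d = 1 := by
  have hs := hθ.ideal a ha
  rw [angleSum_eq h] at hs
  exact triSide_eq_one (hθ.mem_Ioo a b h.1).1 (hθ.mem_Ioo a c h.2.1).1
    (hθ.mem_Ioo a d h.2.2.1).1 hs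

/-! ### Smoothness -/

theorem contDiff_ang (a b : Fin 4) {n : WithTop ℕ∞} : ContDiff ℝ n fun θ => ang θ a b := by
  unfold ang
  split_ifs
  · exact contDiff_const
  · exact contDiff_apply ℝ ℝ _

theorem contDiff_angleSum (v : Fin 4) {n : WithTop ℕ∞} : ContDiff ℝ n fun θ => angleSum θ v :=
  ContDiff.sum fun w _ => contDiff_ang v w

theorem contDiff_dFun (a : Fin 4) {n : WithTop ℕ∞} : ContDiff ℝ n fun θ => dFun θ a := by
  unfold dFun
  refine ((contDiff_const.mul (contDiff_prod fun w _ => (contDiff_ang a w).cos)).add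
    (ContDiff.sum fun w _ => (contDiff_ang a w).cos.pow 2)).sub contDiff_const

theorem contDiff_cFun (a b c d : Fin 4) {n : WithTop ℕ∞} :
    ContDiff ℝ n fun θ => cFun θ a b c d := by
  have h := fun x y : Fin 4 => (contDiff_ang x y (n := n)).cos
  unfold cFun
  exact ((((h a b).mul (((h a d).mul (h b c)).add ((h a c).mul (h b d)))).add
    ((h a c).mul (h b c))).add ((h a d).mul (h b d))).add
    ((h c d).mul ((contDiff_ang a b).sin.pow 2))

theorem edgeLength_mk (θ : TetEdge → ℝ) (a b : Fin 4) (h : ¬ s(a, b).IsDiag) :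
    edgeLength θ ⟨s(a, b), h⟩ = Real.arcosh (coshLength θ a b) := rfl

namespace IsAdmissible

variable {I : Fin 4 → Prop} {θ : TetEdge → ℝ} {a b c d : Fin 4}

theorem contDiffAt_edgeLength (hθ : IsAdmissible I θ) (e : TetEdge) (he : ∀ v ∈ e.1, ¬ I v)
    {n : WithTop ℕ∞} : ContDiffAt ℝ n (fun θ => edgeLength θ e) θ := by
  obtain ⟨e, hd⟩ := e
  induction e with
  | h a b =>
    have ha : ¬ I a := he a (by simp)
    have hb : ¬ I b := he b (by simp)
    have hab : a ≠ b := by simpa using hd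
    have h1 := hθ.dFun_pos ha
    have h2 := hθ.dFun_pos hb
    simp only [edgeLength_mk]
    refine ContDiffAt.comp (g := Real.arcosh) (f := fun θ => coshLength θ a b) θ
      (Real.contDiffAt_arcosh (hθ.one_lt_coshLength hab ha hb)) ?_
    refine (contDiff_cFun _ _ _ _).contDiffAt.div (((contDiff_dFun a).mul
      (contDiff_dFun b)).contDiffAt.sqrt ?_) ?_ <;> positivity

theorem contDiffAt_sinh_boundaryLength (hθ : IsAdmissible I θ) (h : AllDistinct a b c d)
    (ha : ¬ I a) {n : WithTop ℕ∞} :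
    ContDiffAt ℝ n (fun θ => Real.sinh (boundaryLength θ a b c d)) θ := by
  have h2 := hθ.sin_pos h.1
  have h3 := hθ.sin_pos h.2.1
  simp only [boundaryLength_eq]
  refine ContDiffAt.sinh (ContDiffAt.comp (g := Real.arcosh) (f := fun θ => coshBdry θ a b c d) θ
    (Real.contDiffAt_arcosh (hθ.one_lt_coshBdry h ha)) ?_)
  have hc := fun x y : Fin 4 => (contDiff_ang x y (n := n)).cos
  have hs := fun x y : Fin 4 => (contDiff_ang x y (n := n)).sin
  refine (((hc a b).mul (hc a c)).add (hc a d)).contDiffAt.div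
    ((hs a b).mul (hs a c)).contDiffAt ?_
  positivity

end IsAdmissible

theorem sigma_distinct : ∀ i v : Fin 4, v ≠ i →
    AllDistinct (rest i v).1 v (rest i v).2 i ∧ AllDistinct (rest i v).2 v (rest i v).1 i := by
  decide

theorem IsAdmissible.contDiffAt_sigmaAt {I : Fin 4 → Prop} {θ : TetEdge → ℝ}
    (hI : ∀ v w, I v → I w → v = w) (hθ : IsAdmissible I θ)
    {i v : Fin 4} (hv : v ≠ i) (hIv : I v) {n : WithTop ℕ∞} :
    ContDiffAt ℝ n (fun θ => sigmaAt θ i v) θ := by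
  obtain ⟨h1, h2⟩ := sigma_distinct i v hv
  -- Uniqueness of the ideal vertex makes the two other vertices of the face non-ideal, so both
  -- boundary edges have positive length.
  have n1 : ¬ I (rest i v).1 := fun h => h1.1 (hI _ _ h hIv)
  have n2 : ¬ I (rest i v).2 := fun h => h2.1 (hI _ _ h hIv)
  have p1 := hθ.sinh_boundaryLength_pos h1 n1
  have p2 := hθ.sinh_boundaryLength_pos h2 n2
  unfold sigmaAt
  refine ((hθ.contDiffAt_sinh_boundaryLength h1 n1).div
    (hθ.contDiffAt_sinh_boundaryLength h2 n2) p2.ne').log ?_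
  exact (div_pos p1 p2).ne'

theorem isOpen_isAdmissible (I : Fin 4 → Prop) : IsOpen {θ | IsAdmissible I θ} := by
  have e : {θ | IsAdmissible I θ} =
      (⋂ a, ⋂ b, ⋂ _ : a ≠ b, {θ | ang θ a b ∈ Set.Ioo 0 Real.pi}) ∩
      ((⋂ v, ⋂ _ : ¬ I v, {θ | angleSum θ v < Real.pi}) ∩
      (⋂ a, ⋂ b, ⋂ _ : a ≠ b, ⋂ _ : ¬ I a, ⋂ _ : ¬ I b,
        {θ | √(dFun θ a * dFun θ b) < cFun θ a b (rest a b).1 (rest a b).2})) := by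
    ext θ
    simp only [Set.mem_inter_iff, Set.mem_iInter, Set.mem_ofPred_eq]
    exact ⟨fun h => ⟨h.1, h.2, h.3⟩, fun h => ⟨h.1, h.2.1, h.2.2⟩⟩
  rw [e]
  have o1 (a b) : IsOpen {θ : TetEdge → ℝ | ang θ a b ∈ Set.Ioo 0 Real.pi} :=
    isOpen_Ioo.preimage (contDiff_ang a b (n := 0)).continuous
  have o2 (v) : IsOpen {θ : TetEdge → ℝ | angleSum θ v < Real.pi} :=
    isOpen_lt (contDiff_angleSum v (n := 0)).continuous continuous_const
  have o3 (a b) : IsOpen {θ : TetEdge → ℝ |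
      √(dFun θ a * dFun θ b) < cFun θ a b (rest a b).1 (rest a b).2} :=
    isOpen_lt ((contDiff_dFun a (n := 0)).mul (contDiff_dFun b)).continuous.sqrt
      (contDiff_cFun _ _ _ _ (n := 0)).continuous
  refine IsOpen.inter ?_ (IsOpen.inter ?_ ?_)
  · exact isOpen_iInter_of_finite fun a => isOpen_iInter_of_finite fun b =>
      isOpen_iInter_of_finite fun _ => o1 a b
  · exact isOpen_iInter_of_finite fun v => isOpen_iInter_of_finite fun _ => o2 v
  · exact isOpen_iInter_of_finite fun a => isOpen_iInter_of_finite fun b =>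
      isOpen_iInter_of_finite fun _ => isOpen_iInter_of_finite fun _ =>
      isOpen_iInter_of_finite fun _ => o3 a b

/-! ### The cyclic sum of the invariants `σ` -/

/-- The sine at the edge `ab` divides both sinh's and cancels. What remains is a difference of a
function of the vertices alone, so the sum around `v` telescopes. -/
theorem IsAdmissible.sigmaAt_eq {I : Fin 4 → Prop} {θ : TetEdge → ℝ}
    (hI : ∀ v w, I v → I w → v = w) (hθ : IsAdmissible I θ)
    {i v : Fin 4} (hv : v ≠ i) (hIv : I v) :
    sigmaAt θ i v =
      Real.log (√(dFun θ (rest i v).1) / Real.sin (ang θ (rest i v).1 v)) -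
        Real.log (√(dFun θ (rest i v).2) / Real.sin (ang θ (rest i v).2 v)) := by
  obtain ⟨h1, h2⟩ := sigma_distinct i v hv
  unfold sigmaAt
  generalize (rest i v).1 = a at *
  generalize (rest i v).2 = b at *
  have n1 : ¬ I a := fun h => h1.1 (hI _ _ h hIv)
  have n2 : ¬ I b := fun h => h2.1 (hI _ _ h hIv)
  rw [hθ.sinh_boundaryLength h1 n1, hθ.sinh_boundaryLength h2 n2, ang_comm θ b a]
  have p1 := Real.sqrt_pos.2 (hθ.dFun_pos n1)
  have p2 := Real.sqrt_pos.2 (hθ.dFun_pos n2)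
  have s1 := hθ.sin_pos h1.1
  have s2 := hθ.sin_pos h2.1
  have s3 := hθ.sin_pos h1.2.1
  rw [← Real.log_div (by positivity) (by positivity)]
  congr 1
  field_simp

theorem sum_rest_sub (f : Fin 4 → ℝ) (v : Fin 4) :
    ∑ i ∈ Finset.univ.erase v, (f (rest i v).1 - f (rest i v).2) = 0 := by
  have key : ∀ v : Fin 4, ∃ a b c, AllDistinct v a b c ∧ rest a v = (b, c) ∧ rest b v = (c, a) ∧
      rest c v = (a, b) := by decide
  obtain ⟨a, b, c, h, ha, hb, hc⟩ := key v
  obtain ⟨-, -, -, h1, h2, h3⟩ := id h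
  rw [erase_eq v a b c h, Finset.sum_insert (by simp [h1, h2]), Finset.sum_pair h3, ha, hb, hc]
  ring

/-- This holds on an open set of angles, without the angle sum condition at `v`, hence it can be
differentiated in all directions. -/
theorem IsAdmissible.sum_sigmaAt {I : Fin 4 → Prop} {θ : TetEdge → ℝ}
    (hI : ∀ v w, I v → I w → v = w) (hθ : IsAdmissible I θ) {v : Fin 4} (hIv : I v) :
    ∑ i ∈ Finset.univ.erase v, sigmaAt θ i v = 0 := by
  rw [← sum_rest_sub (fun a => Real.log (√(dFun θ a) / Real.sin (ang θ a v))) v]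
  exact Finset.sum_congr rfl fun i hi =>
    hθ.sigmaAt_eq hI (Finset.ne_of_mem_erase hi).symm hIv

/-! ### The lengths and the invariants `σ` are local coordinates -/

theorem hasDerivAt_line {E : Type*} [NormedAddCommGroup E] [NormedSpace ℝ E] {f : E → ℝ} {x : E}
    (hf : DifferentiableAt ℝ f x) (ξ : E) :
    HasDerivAt (fun s : ℝ => f (x + s • ξ)) (fderiv ℝ f x ξ) 0 := by
  have h1 : HasDerivAt (fun s : ℝ => x + s • ξ) ξ 0 := by
    simpa using ((hasDerivAt_id (0 : ℝ)).smul_const ξ).const_add x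
  have h2 : HasFDerivAt f (fderiv ℝ f x) (x + (0 : ℝ) • ξ) := by simpa using hf.hasFDerivAt
  exact h2.comp_hasDerivAt 0 h1

theorem ang_line (θ ξ : TetEdge → ℝ) (s : ℝ) (a b : Fin 4) :
    ang (θ + s • ξ) a b = ang θ a b + s * ang ξ a b := by
  unfold ang
  split_ifs <;> simp

theorem angleSum_line (θ ξ : TetEdge → ℝ) (s : ℝ) (v : Fin 4) :
    angleSum (θ + s • ξ) v = angleSum θ v + s * angleSum ξ v := by
  unfold angleSum
  rw [Finset.mul_sum, ← Finset.sum_add_distrib]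
  exact Finset.sum_congr rfl fun w _ => ang_line θ ξ s v w

/-- The differentials of the lengths of the edges and of the invariants `σ` separate the tangent
vectors of the moduli space of a tetrahedron. -/
theorem IsGeometric.eq_zero_of_fderiv_eq_zero {I : Fin 4 → Prop} {θ : TetEdge → ℝ}
    (hI : ∀ v w, I v → I w → v = w) (hθ : IsGeometric I θ) (ξ : TetEdge → ℝ)
    (hξ : ∀ v, I v → angleSum ξ v = 0)
    (hL : ∀ e : TetEdge, (∀ v ∈ e.1, ¬ I v) → fderiv ℝ (fun θ => edgeLength θ e) θ ξ = 0)
    (hS : ∀ i v, v ≠ i → I v → fderiv ℝ (fun θ => sigmaAt θ i v) θ ξ = 0) : ξ = 0 := by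
  have hadm := hθ.isAdmissible
  set γ : ℝ → TetEdge → ℝ := fun s => θ + s • ξ with hγ
  have γ0 : γ 0 = θ := by simp [hγ]
  have hγc : ContinuousAt γ 0 := by fun_prop
  have evA : ∀ᶠ s in 𝓝 0, IsAdmissible I (γ s) :=
    hγc.eventually ((isOpen_isAdmissible I).mem_nhds (by simpa [γ0] using hadm))
  -- Since `ξ` keeps the ideal angle sums, the line stays in the moduli space for small `s`, where
  -- the link triangle of an ideal vertex is exactly Euclidean.
  have evG : ∀ᶠ s in 𝓝 0, IsGeometric I (γ s) := by
    filter_upwards [evA] with s hs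
    exact ⟨hs.mem_Ioo, fun v hv => by rw [hγ, angleSum_line, hξ v hv, hθ.ideal v hv]; simp,
      hs.nonideal⟩
  have hK : ∀ a b, a ≠ b → ¬ I a → ¬ I b → Stationary fun s => coshLength (γ s) a b := by
    intro a b hab ha hb
    have hd : ¬ s(a, b).IsDiag := by simpa using hab
    have he : ∀ v ∈ s(a, b), ¬ I v := by
      intro v hv
      rcases Sym2.mem_iff.1 hv with rfl | rfl <;> assumption
    have h1 : Stationary fun s => edgeLength (γ s) ⟨s(a, b), hd⟩ := by
      have := hasDerivAt_line ((hadm.contDiffAt_edgeLength ⟨s(a, b), hd⟩ he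
        (n := 1)).differentiableAt one_ne_zero) ξ
      rwa [hL ⟨s(a, b), hd⟩ he] at this
    refine (Stationary.comp Real.differentiable_cosh.differentiableAt h1).congr ?_
    filter_upwards [evA] with s hs
    rw [edgeLength_mk, Real.cosh_arcosh (hs.one_lt_coshLength hab ha hb).le]
  have one_lt {a b c d} (h : AllDistinct a b c d) (ha : ¬ I a) :
      ∀ᶠ s in 𝓝 0, 1 < coshBdry (γ s) a b c d := by
    filter_upwards [evA] with s hs using hs.one_lt_coshBdry h ha
  have hexK {a b c d} (h : AllDistinct a b c d) (ha : ¬ I a) (hb : ¬ I b) :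
      Stationary fun s => hexSide (coshBdry (γ s) a b c d) (coshBdry (γ s) b a c d)
        (coshBdry (γ s) c a b d) := by
    refine (hK a b h.1 ha hb).congr ?_
    filter_upwards [evA] with s hs
    exact (coshLength_eq_hexSide hs.mem_Ioo hs.nonideal h ha hb).symm
  have ratio : ∀ i v, v ≠ i → I v → Stationary fun s =>
      Real.sinh (boundaryLength (γ s) (rest i v).1 v (rest i v).2 i) /
        Real.sinh (boundaryLength (γ s) (rest i v).2 v (rest i v).1 i) := by
    intro i v hv hIv
    have h1 : Stationary fun s => sigmaAt (γ s) i v := by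
      have := hasDerivAt_line ((hadm.contDiffAt_sigmaAt hI hv hIv
        (n := 1)).differentiableAt one_ne_zero) ξ
      rwa [hS i v hv hIv] at this
    refine (Stationary.comp Real.differentiable_exp.differentiableAt h1).congr ?_
    obtain ⟨d1, d2⟩ := sigma_distinct i v hv
    filter_upwards [evA] with s hs
    rw [sigmaAt, Real.exp_log]
    exact div_pos (hs.sinh_boundaryLength_pos d1 fun h => d1.1 (hI _ _ h hIv))
      (hs.sinh_boundaryLength_pos d2 fun h => d2.1 (hI _ _ h hIv))
  have bdry_comm (s : ℝ) (a b c d : Fin 4) : coshBdry (γ s) a b c d = coshBdry (γ s) a c b d :=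
    triSide_comm _ _ _
  -- the sides of an exceptional hexagon with ideal vertex `v`
  have pent {a b v d} (h : AllDistinct a b v d) (hv : I v) :
      Stationary fun s => coshBdry (γ s) a b v d := by
    obtain ⟨hab, hav, had, hbv, hbd, hvd⟩ := id h
    have ha : ¬ I a := fun h => hav (hI _ _ h hv)
    have hb : ¬ I b := fun h => hbv (hI _ _ h hv)
    have h' : AllDistinct b a v d := ⟨hab.symm, hbv, hbd, hav, had, hvd⟩
    refine stationary_of_pentagon (one_lt h ha) (one_lt h' hb) ?_ ?_
    · refine (hexK h ha hb).congr ?_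
      filter_upwards [evG] with s hs
      -- The side at the ideal vertex has cosh equal to 1 along the whole line: the hexagon is a
      -- pentagon.
      rw [hs.coshBdry_eq_one (a := v) ⟨hav.symm, hbv.symm, hvd, hab, had, hbd⟩ hv]
    · have hr := ratio d v hvd hv
      obtain ⟨d1, d2⟩ := sigma_distinct d v hvd
      have sinh_eq {x y} (hx : AllDistinct x v y d) (hx' : ¬ I x) : ∀ᶠ s in 𝓝 0,
          Real.sinh (boundaryLength (γ s) x v y d) = √(coshBdry (γ s) x y v d ^ 2 - 1) := by
        filter_upwards [evA] with s hs
        rw [hs.sinh_boundaryLength hx hx', ← hs.sqrt_coshBdry hx hx', bdry_comm]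
      have hda : AllDistinct a v b d := ⟨hav, hab, had, hbv.symm, hvd, hbd⟩
      have hdb : AllDistinct b v a d := ⟨hbv, hab.symm, hbd, hav.symm, hvd, had⟩
      -- The orientation of the face decides whether `σ` gives the ratio needed or its inverse.
      have cases : rest d v = (a, b) ∨ rest d v = (b, a) :=
        rest_eq d v a b ⟨hvd.symm, had.symm, hbd.symm, hav.symm, hbv.symm, hab⟩
      rcases cases with e | e
      · rw [e] at hr
        refine hr.congr ?_
        filter_upwards [sinh_eq hda ha, sinh_eq hdb hb] with s h1 h2
        rw [h1, h2]
      · rw [e] at hr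
        have p1 := hadm.sinh_boundaryLength_pos hda ha
        have p2 := hadm.sinh_boundaryLength_pos hdb hb
        refine (Stationary.div (.const 1) hr (by simpa only [γ0] using (div_pos p2 p1).ne')).congr ?_
        filter_upwards [sinh_eq hda ha, sinh_eq hdb hb] with s h1 h2
        simp only [h1, h2, one_div_div]
  have bdry {a b c d} (h : AllDistinct a b c d) (ha : ¬ I a) :
      Stationary fun s => coshBdry (γ s) a b c d := by
    obtain ⟨hab, hac, had, hbc, hbd, hcd⟩ := id h
    -- The face `abc` has at most one ideal vertex; if it has one, the pentagon applies, otherwise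
    -- the three internal lengths of the hexagon do.
    by_cases hc : I c
    · exact pent h hc
    by_cases hb : I b
    · simp only [fun s => bdry_comm s a b c d]
      exact pent ⟨hac, hab, had, hbc.symm, hcd, hbd⟩ hb
    have h2 : AllDistinct b a c d := ⟨hab.symm, hbc, hbd, hac, had, hcd⟩
    have h3 : AllDistinct c a b d := ⟨hac.symm, hbc.symm, hcd, hab, had, hbd⟩
    have h4 : AllDistinct a c b d := ⟨hac, hab, had, hbc.symm, hcd, hbd⟩
    have h5 : AllDistinct b c a d := ⟨hbc, hab.symm, hbd, hac.symm, hcd, had⟩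
    refine stationary_of_hexagon (one_lt h ha) (one_lt h2 hb) (one_lt h3 hc) (hexK h ha hb) ?_ ?_
    · refine (hexK h4 ha hc).congr (.of_forall fun s => ?_)
      rw [bdry_comm s a c b]
    · refine (hexK h5 hb hc).congr (.of_forall fun s => ?_)
      rw [bdry_comm s b c a, bdry_comm s c b a]
  have hcos {a b c d} (h : AllDistinct a b c d) (ha : ¬ I a) :
      Stationary fun s => Real.cos (ang (γ s) a b) := by
    obtain ⟨hab, hac, had, hbc, hbd, hcd⟩ := id h
    refine stationary_cos_of_triangle ?_ ?_ ?_ ?_ (bdry h ha)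
      (bdry (b := b) (c := d) (d := c) ⟨hab, had, hac, hbd, hbc, hcd.symm⟩ ha)
      (bdry (b := c) (c := d) (d := b) ⟨hac, had, hab, hcd, hbc.symm, hbd.symm⟩ ha)
    · filter_upwards [evA] with s hs using (hs.mem_Ioo a b hab).1
    · filter_upwards [evA] with s hs using (hs.mem_Ioo a c hac).1
    · filter_upwards [evA] with s hs using (hs.mem_Ioo a d had).1
    · filter_upwards [evA] with s hs
      rw [← angleSum_eq h]
      exact hs.nonideal a ha
  have hang {a b} (hab : a ≠ b) (ha : ¬ I a) : ang ξ a b = 0 := by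
    obtain ⟨c, d, h⟩ := exists_allDistinct a b hab
    have h1 : HasDerivAt (fun s => Real.cos (ang (γ s) a b))
        (-Real.sin (ang θ a b) * ang ξ a b) 0 := by
      have h2 : HasDerivAt (fun s => ang (γ s) a b) (ang ξ a b) 0 := by
        simp only [hγ, ang_line]
        simpa using ((hasDerivAt_id (0 : ℝ)).mul_const (ang ξ a b)).const_add (ang θ a b)
      simpa [γ0] using h2.cos
    have h3 := h1.unique (hcos h ha)
    have h4 := hadm.sin_pos hab
    simpa [h4.ne'] using h3
  funext e
  obtain ⟨e, hd⟩ := e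
  induction e with
  | h a b =>
    have hab : a ≠ b := by simpa using hd
    have : ang ξ a b = 0 := by
      -- An edge has a non-ideal endpoint, and the truncation triangle there controls its angle.
      by_cases ha : I a
      · have hb : ¬ I b := fun hb => hab (hI _ _ ha hb)
        rw [ang_comm]
        exact hang hab.symm hb
      · exact hang hab ha
    simpa [ang, hab] using this

/-- The sum of the angles at `v`, as a linear form. -/
def angleSumLinear (v : Fin 4) : (TetEdge → ℝ) →ₗ[ℝ] ℝ where
  toFun ξ := angleSum ξ v
  map_add' ξ η := by simpa [add_comm] using angleSum_line ξ η 1 v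
  map_smul' c ξ := by
    have := angleSum_line 0 ξ c v
    have h0 : angleSum 0 v = 0 := by simp [angleSum, ang]
    simpa [h0] using this

/-- Three edges miss `v` and three faces contain it, which makes the linear system below square. -/
theorem card_face_edges (v : Fin 4) :
    Fintype.card TetEdge = Fintype.card ({e : TetEdge // v ∉ e.1} ⊕ {i : Fin 4 // v ≠ i}) := by
  revert v
  decide

/-- The differentials of the lengths and of the invariants `σ` take all the values which are
compatible with the vanishing of the cyclic sum of `σ`, on vectors with prescribed angle sum at
the ideal vertex. -/
theorem IsGeometric.exists_fderiv_eq {I : Fin 4 → Prop} {θ : TetEdge → ℝ}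
    (hI : ∀ v w, I v → I w → v = w) (hθ : IsGeometric I θ) (l : TetEdge → ℝ) (τ : Fin 4 → ℝ)
    (m : ℝ) (hτ : ∀ v, I v → ∑ i ∈ Finset.univ.erase v, τ i = 0) :
    ∃ ξ : TetEdge → ℝ, (∀ v, I v → angleSum ξ v = m) ∧
      (∀ e : TetEdge, (∀ v ∈ e.1, ¬ I v) → fderiv ℝ (fun θ => edgeLength θ e) θ ξ = l e) ∧
      (∀ i v, v ≠ i → I v → fderiv ℝ (fun θ => sigmaAt θ i v) θ ξ = τ i) := by
  by_cases hne : ∃ v, I v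
  · obtain ⟨v, hv⟩ := hne
    have hIv : ∀ w, I w ↔ w = v := fun w => ⟨fun h => hI _ _ h hv, fun h => h ▸ hv⟩
    have he : ∀ e : TetEdge, (∀ w ∈ e.1, ¬ I w) ↔ v ∉ e.1 := by
      intro e
      simp only [hIv]
      exact ⟨fun h h' => h v h' rfl, fun h w hw e => h (e ▸ hw)⟩
    have hsum : ∀ ξ, ∑ i ∈ Finset.univ.erase v, fderiv ℝ (fun θ => sigmaAt θ i v) θ ξ = 0 := by
      intro ξ
      have h1 : HasFDerivAt (fun θ => ∑ i ∈ Finset.univ.erase v, sigmaAt θ i v)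
          (∑ i ∈ Finset.univ.erase v, fderiv ℝ (fun θ => sigmaAt θ i v) θ) θ := by
        refine HasFDerivAt.fun_sum fun i hi => ?_
        exact ((hθ.isAdmissible.contDiffAt_sigmaAt hI (Finset.ne_of_mem_erase hi).symm hv
          (n := 1)).differentiableAt one_ne_zero).hasFDerivAt
      have h2 : HasFDerivAt (fun θ => ∑ i ∈ Finset.univ.erase v, sigmaAt θ i v)
          (0 : (TetEdge → ℝ) →L[ℝ] ℝ) θ := by
        refine (hasFDerivAt_const (0 : ℝ) θ).congr_of_eventuallyEq ?_
        filter_upwards [(isOpen_isAdmissible I).mem_nhds hθ.isAdmissible] with θ' h'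
        exact IsAdmissible.sum_sigmaAt hI h' hv
      have := congrArg (fun f => f ξ) (h1.unique h2)
      simpa using this
    -- The three differentials of `σ` sum to zero, so adding the angle sum at `v` to each loses
    -- nothing: the total of the last three components is three times the angle sum. This gives an
    -- endomorphism-sized map, and injectivity yields surjectivity.
    let Ψ : (TetEdge → ℝ) →ₗ[ℝ] ({e : TetEdge // v ∉ e.1} ⊕ {i : Fin 4 // v ≠ i} → ℝ) :=
      LinearMap.pi (Sum.elim (fun e => (fderiv ℝ (fun θ => edgeLength θ e.1) θ).toLinearMap)
        (fun i => (fderiv ℝ (fun θ => sigmaAt θ i.1 v) θ).toLinearMap + angleSumLinear v))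
    have Ψl (ξ e) : Ψ ξ (Sum.inl e) = fderiv ℝ (fun θ => edgeLength θ e.1) θ ξ := rfl
    have Ψr (ξ i) : Ψ ξ (Sum.inr i) =
      fderiv ℝ (fun θ => sigmaAt θ i.1 v) θ ξ + angleSum ξ v := rfl
    have hkey : ∀ ξ (τ : Fin 4 → ℝ) (m : ℝ), ∑ i ∈ Finset.univ.erase v, τ i = 0 →
        (∀ i, Ψ ξ (Sum.inr i) = τ i.1 + m) → angleSum ξ v = m := by
      intro ξ τ m h0 h
      have h1 : ∑ i ∈ Finset.univ.erase v,
          (fderiv ℝ (fun θ => sigmaAt θ i v) θ ξ + angleSum ξ v) =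
          ∑ i ∈ Finset.univ.erase v, (τ i + m) :=
        Finset.sum_congr rfl fun i hi => h ⟨i, (Finset.ne_of_mem_erase hi).symm⟩
      rw [Finset.sum_add_distrib, Finset.sum_add_distrib, hsum, h0] at h1
      simpa using h1
    have hinj : Function.Injective Ψ := by
      rw [← LinearMap.ker_eq_bot, LinearMap.ker_eq_bot']
      intro ξ hξ
      have hm := hkey ξ 0 0 (by simp) fun i => by simp [hξ]
      refine hθ.eq_zero_of_fderiv_eq_zero hI ξ ?_ ?_ ?_
      · intro w hw
        rw [(hIv w).1 hw, hm]
      · intro e h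
        rw [← Ψl ξ ⟨e, (he e).1 h⟩, hξ]; rfl
      · intro i w hi hw
        obtain rfl := (hIv w).1 hw
        have := Ψr ξ ⟨i, hi⟩
        rw [hξ, hm] at this
        simpa using this.symm
    have hsurj : Function.Surjective Ψ :=
      (LinearMap.injective_iff_surjective_of_finrank_eq_finrank (by
        rw [Module.finrank_fintype_fun_eq_card, Module.finrank_fintype_fun_eq_card,
          card_face_edges v])).1 hinj
    obtain ⟨ξ, hξ⟩ := hsurj (Sum.elim (fun e => l e.1) fun i => τ i.1 + m)
    have hm := hkey ξ τ m (hτ v hv) fun i => by rw [hξ]; rfl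
    refine ⟨ξ, fun w hw => by rw [(hIv w).1 hw, hm], fun e h => ?_, fun i w hi hw => ?_⟩
    · rw [← Ψl ξ ⟨e, (he e).1 h⟩, hξ]; rfl
    · obtain rfl := (hIv w).1 hw
      have := Ψr ξ ⟨i, hi⟩
      rw [hξ, hm] at this
      simpa using this.symm
  -- Without ideal vertices the six lengths alone form a square system.
  · have hno : ∀ v, ¬ I v := fun v hv => hne ⟨v, hv⟩
    let Ψ : (TetEdge → ℝ) →ₗ[ℝ] (TetEdge → ℝ) :=
      LinearMap.pi fun e => (fderiv ℝ (fun θ => edgeLength θ e) θ).toLinearMap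
    have Ψe (ξ e) : Ψ ξ e = fderiv ℝ (fun θ => edgeLength θ e) θ ξ := rfl
    have hinj : Function.Injective Ψ := by
      rw [← LinearMap.ker_eq_bot, LinearMap.ker_eq_bot']
      intro ξ hξ
      refine hθ.eq_zero_of_fderiv_eq_zero hI ξ (fun v hv => (hno v hv).elim) (fun e _ => ?_)
        fun i v _ hv => (hno v hv).elim
      rw [← Ψe, hξ]; rfl
    obtain ⟨ξ, hξ⟩ := LinearMap.injective_iff_surjective.1 hinj l
    exact ⟨ξ, fun v hv => (hno v hv).elim, fun e _ => by rw [← Ψe, hξ],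
      fun i v _ hv => (hno v hv).elim⟩

/-! ### Regular level sets -/

/-- The chart is `H` completed by a linear projection onto the kernel of its differential; the
inverse function theorem applies to the pair. -/
theorem isSmoothManifoldNear_of_surjective_fderiv {E : Type*} [NormedAddCommGroup E]
    [NormedSpace ℝ E] [FiniteDimensional ℝ E] {ι : Type*} [Fintype ι] {H : E → ι → ℝ} {U S : Set E}
    (hU : IsOpen U) (hH : ∀ x ∈ U, ContDiffAt ℝ ∞ H x) (hS : ∀ x ∈ U, x ∈ S ↔ H x = 0) {x₀ : E}
    (hx₀ : x₀ ∈ U) (h0 : H x₀ = 0) (hsurj : Function.Surjective (fderiv ℝ H x₀)) {n : ℕ}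
    (hn : Module.finrank ℝ E = n + Fintype.card ι) : IsSmoothManifoldNear S n x₀ := by
  have : CompleteSpace E := FiniteDimensional.complete ℝ E
  refine ⟨(hS x₀ hx₀).2 h0, Fintype.card ι, ?_⟩
  set H' := fderiv ℝ H x₀ with hH'
  let K := LinearMap.ker H'.toLinearMap
  have hK : Module.finrank ℝ K = Module.finrank ℝ (Fin n → ℝ) := by
    have h1 := LinearMap.finrank_range_add_finrank_ker H'.toLinearMap
    rw [LinearMap.range_eq_top.2 hsurj, finrank_top, hn, Module.finrank_fintype_fun_eq_card] at h1
    rw [Module.finrank_fin_fun]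
    change Module.finrank ℝ (LinearMap.ker H'.toLinearMap) = n
    omega
  obtain ⟨p, hp⟩ := LinearMap.exists_leftInverse_of_injective K.subtype K.ker_subtype
  let A : E →L[ℝ] (Fin n → ℝ) :=
    LinearMap.toContinuousLinearMap ((LinearEquiv.ofFinrankEq K (Fin n → ℝ) hK).toLinearMap ∘ₗ p)
  let e : (ι → ℝ) ≃L[ℝ] (Fin (Fintype.card ι) → ℝ) :=
    ContinuousLinearEquiv.ofFinrankEq (by simp)
  let G : E → (Fin n → ℝ) × (Fin (Fintype.card ι) → ℝ) := fun x => (A x, e (H x))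
  have hG : ∀ x ∈ U, ContDiffAt ℝ ∞ G x := fun x hx =>
    A.contDiff.contDiffAt.prodMk (e.contDiff.contDiffAt.comp x (hH x hx))
  let G' : E →L[ℝ] (Fin n → ℝ) × (Fin (Fintype.card ι) → ℝ) :=
    A.prod ((e : (ι → ℝ) →L[ℝ] _).comp H')
  have hGder : HasFDerivAt G G' x₀ :=
    A.hasFDerivAt.prodMk (e.hasFDerivAt.comp x₀
      ((hH x₀ hx₀).differentiableAt (by simp)).hasFDerivAt)
  have hinj : Function.Injective G'.toLinearMap := by
    rw [← LinearMap.ker_eq_bot, LinearMap.ker_eq_bot']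
    intro ξ hξ
    have h1 : A ξ = 0 := congrArg Prod.fst hξ
    have h2 : e (H' ξ) = 0 := congrArg Prod.snd hξ
    have h3 : ξ ∈ K := by
      change H' ξ = 0
      simpa using h2
    have h4 : p ξ = 0 := by
      have : (LinearEquiv.ofFinrankEq K (Fin n → ℝ) hK) (p ξ) = 0 := h1
      simpa using this
    have h5 : p ξ = ⟨ξ, h3⟩ := LinearMap.congr_fun hp ⟨ξ, h3⟩
    rw [h4] at h5
    exact (congrArg Subtype.val h5).symm
  let Ge : E ≃L[ℝ] (Fin n → ℝ) × (Fin (Fintype.card ι) → ℝ) :=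
    (LinearEquiv.ofInjectiveOfFinrankEq G'.toLinearMap hinj
      (by simp [hn])).toContinuousLinearEquiv
  have hGe : (Ge : E →L[ℝ] (Fin n → ℝ) × (Fin (Fintype.card ι) → ℝ)) = G' := by
    ext1 ξ; rfl
  have hGder' : HasFDerivAt G (Ge : E →L[ℝ] _) x₀ := hGe ▸ hGder
  -- The chart is restricted to where the differential of `G` is invertible, so that the inverse is
  -- smooth on its entire domain and not only at the image of `x₀`.
  let V : Set E := U ∩ fderiv ℝ G ⁻¹' Set.range
    ((↑) : (E ≃L[ℝ] (Fin n → ℝ) × (Fin (Fintype.card ι) → ℝ)) → E →L[ℝ] _)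
  have hGU : ContDiffOn ℝ ∞ G U := fun x hx => (hG x hx).contDiffWithinAt
  have hV : IsOpen V :=
    (hGU.continuousOn_fderiv_of_isOpen hU (by simp)).isOpen_inter_preimage hU
      (ContinuousLinearEquiv.isOpen)
  let φ₀ := (hG x₀ hx₀).toOpenPartialHomeomorph G hGder' (by simp)
  have hφ₀ : x₀ ∈ φ₀.source := (hG x₀ hx₀).mem_toOpenPartialHomeomorph_source hGder' (by simp)
  have hx₀V : x₀ ∈ V := ⟨hx₀, Ge, hGder'.fderiv.symm⟩
  refine ⟨φ₀.restrOpen V hV, ⟨hφ₀, hx₀V⟩, ?_, ?_, ?_⟩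
  · exact fun x hx => (hG x hx.2.1).contDiffWithinAt
  · intro y hy
    have hx := (φ₀.restrOpen V hV).map_target hy
    obtain ⟨-, hxU, g, hg⟩ := hx
    refine ContDiffAt.contDiffWithinAt ((φ₀.restrOpen V hV).contDiffAt_symm hy (f₀' := g) ?_
      (hG _ hxU))
    rw [hg]
    exact ((hG _ hxU).differentiableAt (by simp)).hasFDerivAt
  · intro x hx
    rw [hS x hx.2.1]
    change H x = 0 ↔ e (H x) = 0
    simp

/-! ### Combinatorics of the triangulation -/

theorem FacePairing.pairedFace_pairedFace {T : Type*} (P : FacePairing T) (F : T × Fin 4) :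
    P.pairedFace (P.pairedFace F) = F := by
  obtain ⟨t, i⟩ := F
  simp [FacePairing.pairedFace, P.adj_adj, P.glue_glue]

theorem FacePairing.pairedFace_ne {T : Type*} (P : FacePairing T) (F : T × Fin 4) :
    P.pairedFace F ≠ F := P.face_ne F.1 F.2

theorem FacePairing.pair_eq_iff {T : Type*} (P : FacePairing T) {F G : T × Fin 4} :
    s(F, P.pairedFace F) = s(G, P.pairedFace G) ↔ F = G ∨ F = P.pairedFace G := by
  rw [Sym2.eq_iff]
  constructor
  · rintro (h | h)
    exacts [.inl h.1, .inr h.1]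
  · rintro (rfl | rfl)
    exacts [.inl ⟨rfl, rfl⟩, .inr ⟨rfl, P.pairedFace_pairedFace _⟩]

namespace Triangulation

variable {T : Type*} (𝒯 : Triangulation T)

theorem mk_vertex_glue (t : T) {i v : Fin 4} (h : v ≠ i) :
    Quotient.mk 𝒯.vertexSetoid (𝒯.adj t i, 𝒯.glue t i v) = Quotient.mk 𝒯.vertexSetoid (t, v) :=
  (Quotient.sound (Relation.EqvGen.rel _ _ ⟨i, h.symm, rfl⟩)).symm

theorem isIdeal_glue (t : T) {i v : Fin 4} (h : v ≠ i) :
    𝒯.IsIdeal (𝒯.adj t i) (𝒯.glue t i v) ↔ 𝒯.IsIdeal t v := by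
  unfold IsIdeal
  rw [mk_vertex_glue 𝒯 t h]

theorem IsExceptional.pairedFace {F : T × Fin 4} (h : 𝒯.IsExceptional F) :
    𝒯.IsExceptional (𝒯.pairedFace F) := by
  obtain ⟨v, hv, hI⟩ := h
  exact ⟨𝒯.glue F.1 F.2 v, fun h => hv ((𝒯.glue F.1 F.2).injective h),
    (𝒯.isIdeal_glue F.1 hv).2 hI⟩

theorem isCompactEdge_of_edgeStep {x y : T × TetEdge} (h : 𝒯.EdgeStep x y) :
    𝒯.IsCompactEdge x ↔ 𝒯.IsCompactEdge y := by
  obtain ⟨i, hi, h1, h2⟩ := h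
  unfold IsCompactEdge
  rw [h1, h2]
  simp only [Sym2.mem_map, forall_exists_index, and_imp, forall_apply_eq_imp_iff₂]
  refine forall₂_congr fun v hv => not_congr ?_
  exact (𝒯.isIdeal_glue x.1 (by rintro rfl; exact hi hv)).symm

theorem isCompactEdge_iff_of_mk_eq {x y : T × TetEdge}
    (h : Quotient.mk 𝒯.edgeSetoid x = Quotient.mk 𝒯.edgeSetoid y) :
    𝒯.IsCompactEdge x ↔ 𝒯.IsCompactEdge y := by
  have h' : Relation.EqvGen 𝒯.EdgeStep x y := Quotient.exact h
  induction h' with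
  | rel _ _ h1 => exact 𝒯.isCompactEdge_of_edgeStep h1
  | refl _ => rfl
  | symm _ _ h1 ih => exact (ih (Quotient.sound h1)).symm
  | trans _ _ _ h1 h2 ih1 ih2 => exact (ih1 (Quotient.sound h1)).trans (ih2 (Quotient.sound h2))

/-- The tetrahedra with an ideal vertex. -/
abbrev NoncompactTet : Type _ := {t : T // ∃ v, 𝒯.IsIdeal t v}

variable {𝒯}

/-- The ideal vertex of a tetrahedron. -/
def NoncompactTet.vertex (t : 𝒯.NoncompactTet) : Fin 4 := t.2.choose

theorem NoncompactTet.isIdeal_vertex (t : 𝒯.NoncompactTet) : 𝒯.IsIdeal t.1 t.vertex :=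
  t.2.choose_spec

/-! ### Counting exceptional faces and compact edges. -/

theorem card_ne_vertex (v : Fin 4) : Fintype.card {i : Fin 4 // v ≠ i} = 3 := by
  revert v; decide

theorem card_mem_edge (v : Fin 4) : Fintype.card {e : TetEdge // v ∈ e.1} = 3 := by
  revert v; decide

theorem card_tetEdge : Fintype.card TetEdge = 6 := by decide

theorem card_exceptional [Finite T] (hgood : 𝒯.IsGood) :
    Nat.card {F // 𝒯.IsExceptional F} = 3 * 𝒯.numNoncompactTets := by
  let f : {F // 𝒯.IsExceptional F} → Σ t : 𝒯.NoncompactTet, {i : Fin 4 // t.vertex ≠ i} :=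
    fun F => ⟨⟨F.1.1, F.2.choose, F.2.choose_spec.2⟩, F.1.2, by
      have h := F.2.choose_spec
      rw [hgood F.1.1 _ _ (NoncompactTet.isIdeal_vertex ⟨F.1.1, F.2.choose, h.2⟩) h.2]
      exact h.1⟩
  let g : (Σ t : 𝒯.NoncompactTet, {i : Fin 4 // t.vertex ≠ i}) → {F // 𝒯.IsExceptional F} :=
    fun y => ⟨(y.1.1, y.2.1), y.1.vertex, y.2.2, y.1.isIdeal_vertex⟩
  have := Fintype.ofFinite 𝒯.NoncompactTet
  rw [Nat.card_congr (⟨f, g, fun _ => rfl, fun _ => rfl⟩ : _ ≃ _), Nat.card_sigma]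
  simp only [Nat.card_eq_fintype_card, card_ne_vertex]
  simp [numNoncompactTets, mul_comm]

theorem isCompactEdge_iff (hgood : 𝒯.IsGood) (t : 𝒯.NoncompactTet) (e : TetEdge) :
    𝒯.IsCompactEdge (t.1, e) ↔ t.vertex ∉ e.1 := by
  constructor
  · exact fun h hv => h _ hv t.isIdeal_vertex
  · exact fun h v hv hI => h (hgood _ _ _ t.isIdeal_vertex hI ▸ hv)

theorem card_not_compact [Finite T] (hgood : 𝒯.IsGood) :
    Nat.card {x // ¬ 𝒯.IsCompactEdge x} = 3 * 𝒯.numNoncompactTets := by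
  have h1 : ∀ x : {x // ¬ 𝒯.IsCompactEdge x}, ∃ v, 𝒯.IsIdeal x.1.1 v := by
    rintro ⟨x, hx⟩
    unfold IsCompactEdge at hx
    push Not at hx
    obtain ⟨v, -, hv⟩ := hx
    exact ⟨v, hv⟩
  let f : {x // ¬ 𝒯.IsCompactEdge x} → Σ t : 𝒯.NoncompactTet, {e : TetEdge // t.vertex ∈ e.1} :=
    fun x => ⟨⟨x.1.1, h1 x⟩, x.1.2, not_not.1
      (mt (isCompactEdge_iff hgood ⟨x.1.1, h1 x⟩ x.1.2).2 x.2)⟩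
  let g : (Σ t : 𝒯.NoncompactTet, {e : TetEdge // t.vertex ∈ e.1}) → {x // ¬ 𝒯.IsCompactEdge x} :=
    fun y => ⟨(y.1.1, y.2.1), fun h => h _ y.2.2 y.1.isIdeal_vertex⟩
  have := Fintype.ofFinite 𝒯.NoncompactTet
  rw [Nat.card_congr (⟨f, g, fun _ => rfl, fun _ => rfl⟩ : _ ≃ _), Nat.card_sigma]
  simp only [Nat.card_eq_fintype_card, card_mem_edge]
  simp [numNoncompactTets, mul_comm]

theorem card_compact [Finite T] (hgood : 𝒯.IsGood) :
    Nat.card {x // 𝒯.IsCompactEdge x} + 3 * 𝒯.numNoncompactTets = 6 * Nat.card T := by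
  classical
  rw [← card_not_compact hgood, ← Nat.card_sum,
    Nat.card_congr (Equiv.sumCompl 𝒯.IsCompactEdge), Nat.card_prod, Nat.card_eq_fintype_card
    (α := TetEdge), card_tetEdge, mul_comm]

variable (𝒯) in
/-- The unordered pairs of matching exceptional hexagons. -/
abbrev ExceptionalPair : Type _ :=
  {q : Sym2 (T × Fin 4) // ∃ F, 𝒯.IsExceptional F ∧ q = s(F, 𝒯.pairedFace F)}

/-- The face pairing is an involution without fixed points that preserves exceptional faces. With
`card_exceptional` this gives `3p` as twice the number of pairs, so `p` is even. -/
theorem card_exceptional_eq_two_mul [Finite T] :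
    Nat.card {F // 𝒯.IsExceptional F} = 2 * Nat.card 𝒯.ExceptionalPair := by
  let f : {F // 𝒯.IsExceptional F} → 𝒯.ExceptionalPair := fun F =>
    ⟨s(F.1, 𝒯.pairedFace F.1), F.1, F.2, rfl⟩
  have := Fintype.ofFinite 𝒯.ExceptionalPair
  rw [← Nat.card_congr (Equiv.sigmaFiberEquiv f), Nat.card_sigma]
  have h : ∀ q, Nat.card {F // f F = q} = 2 := by
    rintro ⟨q, F, hF, rfl⟩
    rw [Nat.card_eq_two_iff]
    refine ⟨⟨⟨F, hF⟩, rfl⟩, ⟨⟨𝒯.pairedFace F, hF.pairedFace⟩,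
      Subtype.ext (𝒯.pair_eq_iff.2 (.inr rfl))⟩, ?_, ?_⟩
    · intro h
      exact 𝒯.pairedFace_ne F (congrArg (fun x => x.1.1) h).symm
    · rw [Set.eq_univ_iff_forall]
      rintro ⟨⟨G, hG⟩, h⟩
      rcases 𝒯.pair_eq_iff.1 (congrArg Subtype.val h) with rfl | rfl
      · exact .inl rfl
      · exact .inr rfl
  simp [h, mul_comm]

namespace EquationChoice

variable (ch : 𝒯.EquationChoice)

theorem isCompactEdge_base (E : 𝒯.CompactEdge) : 𝒯.IsCompactEdge (ch.base E) := by
  obtain ⟨x, hx, hc⟩ := E.2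
  exact (𝒯.isCompactEdge_iff_of_mk_eq (hx.trans (ch.base_spec E).symm)).1 hc

theorem base_injective : Function.Injective ch.base := fun E E' h =>
  Subtype.ext (by rw [← ch.base_spec E, h, ch.base_spec E'])

theorem exists_ideal_drop (κ : 𝒯.Cusp) : ∃ v, v ≠ (ch.drop κ).2 ∧
    𝒯.IsIdeal (ch.drop κ).1 v ∧ Quotient.mk 𝒯.vertexSetoid ((ch.drop κ).1, v) = κ.1 := by
  obtain ⟨v, h1, h2⟩ := ch.drop_spec κ
  refine ⟨v, h1, ?_, h2⟩
  unfold IsIdeal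
  rw [h2]
  exact κ.2

/-! ### Counting the equations. -/

theorem card_lengthEq [Finite T] :
    Nat.card ch.LengthEq + 𝒯.numCompactEdges = Nat.card {x // 𝒯.IsCompactEdge x} := by
  unfold numCompactEdges
  rw [← Nat.card_sum]
  refine Nat.card_congr (Equiv.ofBijective (Sum.elim (fun x => ⟨x.1, x.2.1⟩)
    fun E => ⟨ch.base E, ch.isCompactEdge_base E⟩) ⟨?_, ?_⟩)
  · refine Function.Injective.sumElim ?_ ?_ ?_
    · exact fun x y h => Subtype.ext (congrArg (fun z => z.1) h)
    · exact fun E E' h => ch.base_injective (congrArg Subtype.val h)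
    · exact fun x E h => x.2.2 E (congrArg Subtype.val h).symm
  · rintro ⟨x, hx⟩
    by_cases h : ∃ E, ch.base E = x
    · obtain ⟨E, rfl⟩ := h
      exact ⟨.inr E, rfl⟩
    · push Not at h
      exact ⟨.inl ⟨x, hx, h⟩, rfl⟩

/-- Each exceptional face has a single ideal vertex and gluing preserves it, so a pair determines
its cusp. Hence exactly `k` pairs are discarded. -/
theorem drop_pair_injective (hgood : 𝒯.IsGood) :
    Function.Injective fun κ => s(ch.drop κ, 𝒯.pairedFace (ch.drop κ)) := by
  intro κ κ' h
  obtain ⟨v, h1, h2, h3⟩ := ch.exists_ideal_drop κ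
  obtain ⟨w, k1, k2, k3⟩ := ch.exists_ideal_drop κ'
  refine Subtype.ext (h3.symm.trans (Eq.trans ?_ k3))
  rcases 𝒯.pair_eq_iff.1 h with e | e
  · rw [e] at h2 ⊢
    rw [hgood _ _ _ h2 k2]
  · rw [e] at h2 ⊢
    have k4 := (𝒯.isIdeal_glue (ch.drop κ').1 k1).2 k2
    rw [hgood _ _ _ h2 k4]
    exact 𝒯.mk_vertex_glue _ k1

theorem card_sigmaEq [Finite T] (hgood : 𝒯.IsGood) :
    Nat.card ch.SigmaEq + 𝒯.numCusps = Nat.card 𝒯.ExceptionalPair := by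
  unfold numCusps
  rw [← Nat.card_sum]
  refine Nat.card_congr (Equiv.ofBijective (Sum.elim (fun x => ⟨x.1, x.2.1⟩)
    fun κ => ⟨s(ch.drop κ, 𝒯.pairedFace (ch.drop κ)), ch.drop κ,
      (ch.exists_ideal_drop κ).imp fun v h => ⟨h.1, h.2.1⟩, rfl⟩) ⟨?_, ?_⟩)
  · refine Function.Injective.sumElim ?_ ?_ ?_
    · exact fun x y h => Subtype.ext (congrArg (fun z => z.1) h)
    · exact fun E E' h => ch.drop_pair_injective hgood (congrArg Subtype.val h)
    · exact fun x E h => x.2.2 E (congrArg Subtype.val h)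
  · rintro ⟨x, hx⟩
    by_cases h : ∃ κ, s(ch.drop κ, 𝒯.pairedFace (ch.drop κ)) = x
    · obtain ⟨κ, rfl⟩ := h
      exact ⟨.inr κ, rfl⟩
    · push Not at h
      exact ⟨.inl ⟨x, hx, fun κ e => h κ e.symm⟩, rfl⟩

/-! ### Solving the linearized equations -/

/-- The sum of the values of a function on a pair of faces. -/
def pairSum (τ : T × Fin 4 → ℝ) (q : Sym2 (T × Fin 4)) : ℝ :=
  Sym2.lift ⟨fun F F' => τ F + τ F', fun _ _ => add_comm _ _⟩ q

/-- The sums over the pairs of faces not discarded, and over the exceptional faces of each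
tetrahedron, of a function defined on the faces. -/
def faceSums : (T × Fin 4 → ℝ) →ₗ[ℝ] (ch.SigmaEq ⊕ 𝒯.NoncompactTet → ℝ) where
  toFun τ := Sum.elim (fun q => pairSum τ q.1)
    fun t => ∑ i ∈ Finset.univ.erase t.vertex, τ (t.1, i)
  map_add' τ τ' := by
    ext (q | t)
    · obtain ⟨q, hq⟩ := q
      induction q with
      | h F F' => simp only [Sum.elim_inl, pairSum, Sym2.lift_mk, Pi.add_apply]; ring
    · simp [Finset.sum_add_distrib]
  map_smul' c τ := by
    ext (q | t)
    · obtain ⟨q, hq⟩ := q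
      induction q with
      | h F F' => simp [pairSum, mul_add]
    · exact (Finset.mul_sum _ _ _).symm

-- A face contributes once to its tetrahedron and, its partner being a different face, once to its
-- pair, unless that pair is discarded.
open Classical in
theorem faceSums_single (hgood : 𝒯.IsGood) {t : T} {i v : Fin 4} (hv : v ≠ i)
    (hI : 𝒯.IsIdeal t v) :
    ch.faceSums (Pi.single (t, i) 1) =
      (if h : ∀ κ, s((t, i), 𝒯.pairedFace (t, i)) ≠ s(ch.drop κ, 𝒯.pairedFace (ch.drop κ)) then
        Pi.single (.inl ⟨s((t, i), 𝒯.pairedFace (t, i)), ⟨(t, i), ⟨v, hv, hI⟩, rfl⟩, h⟩) 1 else 0)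
      + Pi.single (.inr ⟨t, v, hI⟩) 1 := by
  funext j
  rcases j with ⟨q, ⟨F, hF, rfl⟩, hq⟩ | u
  · have h1 : ch.faceSums (Pi.single (t, i) 1) (.inl ⟨s(F, 𝒯.pairedFace F), ⟨F, hF, rfl⟩, hq⟩) =
        if s((t, i), 𝒯.pairedFace (t, i)) = s(F, 𝒯.pairedFace F) then 1 else 0 := by
      change (Pi.single (t, i) 1 : T × Fin 4 → ℝ) F
        + (Pi.single (t, i) 1 : T × Fin 4 → ℝ) (𝒯.pairedFace F) = _
      simp only [Pi.single_apply, 𝒯.pair_eq_iff]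
      have := 𝒯.pairedFace_ne F
      by_cases e : F = (t, i)
      · subst e
        simp [this]
      · have e' : ¬ (t, i) = F := fun h => e h.symm
        simp [e, e', eq_comm]
    rw [h1]
    by_cases e : s((t, i), 𝒯.pairedFace (t, i)) = s(F, 𝒯.pairedFace F)
    · have : ∀ κ, s((t, i), 𝒯.pairedFace (t, i)) ≠ s(ch.drop κ, 𝒯.pairedFace (ch.drop κ)) :=
        fun κ => e ▸ hq κ
      have hj : (⟨s(F, 𝒯.pairedFace F), ⟨F, hF, rfl⟩, hq⟩ : ch.SigmaEq) =
          ⟨s((t, i), 𝒯.pairedFace (t, i)), ⟨(t, i), ⟨v, hv, hI⟩, rfl⟩, this⟩ := Subtype.ext e.symm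
      rw [if_pos e, Pi.add_apply, dif_pos this, Pi.single_eq_of_ne Sum.inl_ne_inr, add_zero, hj,
        Pi.single_eq_same]
    · have e' : ¬ s(F, 𝒯.pairedFace F) = s((t, i), 𝒯.pairedFace (t, i)) := fun h => e h.symm
      split_ifs with h <;> simp [e']
  · have h1 : ch.faceSums (Pi.single (t, i) 1) (.inr u) = if u.1 = t then 1 else 0 := by
      change ∑ k ∈ Finset.univ.erase u.vertex, (Pi.single (t, i) 1 : T × Fin 4 → ℝ) (u.1, k) = _
      simp only [Pi.single_apply, Prod.mk.injEq]
      by_cases e : u.1 = t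
      · have : u.vertex = v := hgood t _ _ (e ▸ u.isIdeal_vertex) hI
        simp [e, this, hv.symm]
      · simp [e]
    rw [h1]
    split_ifs with h2 h3 <;> simp [Pi.single_apply, Subtype.ext_iff, h2]

/-- By duality it suffices that a functional vanishing on the range is zero. Testing it on single
faces, the weights of a pair and of a tetrahedron containing one of its faces are opposite. Thus the
tetrahedron weight is constant around each cusp, and it vanishes since the discarded pair carries no
weight. -/
theorem faceSums_surjective [Finite T] (hgood : 𝒯.IsGood) :
    Function.Surjective ch.faceSums := by
  classical
  have := Fintype.ofFinite T
  have := Fintype.ofFinite 𝒯.NoncompactTet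
  rw [← LinearMap.range_eq_top]
  by_contra hne
  obtain ⟨φ, hφ, hle⟩ := Submodule.exists_le_ker_of_lt_top _ (lt_top_iff_ne_top.2 hne)
  refine hφ ?_
  have hzero : ∀ τ, φ (ch.faceSums τ) = 0 := fun τ => hle ⟨τ, rfl⟩
  -- Extending the pair weight by zero to discarded pairs lets `hWu` hold for every exceptional
  -- face.
  let W : Sym2 (T × Fin 4) → ℝ := fun q => if h : (∃ F, 𝒯.IsExceptional F ∧
    q = s(F, 𝒯.pairedFace F)) ∧ ∀ κ, q ≠ s(ch.drop κ, 𝒯.pairedFace (ch.drop κ)) then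
      φ (Pi.single (.inl ⟨q, h⟩) 1) else 0
  let u : T × Fin 4 → ℝ := fun x => if h : 𝒯.IsIdeal x.1 x.2 then
    φ (Pi.single (.inr ⟨x.1, x.2, h⟩) 1) else 0
  have hWu : ∀ t i v, v ≠ i → 𝒯.IsIdeal t v →
      W s((t, i), 𝒯.pairedFace (t, i)) + u (t, v) = 0 := by
    intro t i v hv hI
    have h := hzero (Pi.single (t, i) 1)
    rw [ch.faceSums_single hgood hv hI, map_add] at h
    have hex : ∃ F, 𝒯.IsExceptional F ∧
        s((t, i), 𝒯.pairedFace (t, i)) = s(F, 𝒯.pairedFace F) := ⟨(t, i), ⟨v, hv, hI⟩, rfl⟩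
    simp only [W, u, hI, dif_pos, hex, true_and]
    split_ifs at h ⊢ with h1
    · exact h
    · simpa using h
  -- Two tetrahedra glued along an exceptional face share the weight of that pair.
  have hstep : ∀ x y, 𝒯.VertexStep x y → u x = u y := by
    rintro ⟨t, v⟩ y ⟨i, hi, rfl⟩
    by_cases hI : 𝒯.IsIdeal t v
    · have hI' := (𝒯.isIdeal_glue t (Ne.symm hi)).2 hI
      have h1 := hWu t i v (Ne.symm hi) hI
      have h2 := hWu (𝒯.adj t i) (𝒯.glue t i i) (𝒯.glue t i v)
        (fun h => hi ((𝒯.glue t i).injective h).symm) hI'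
      have h3 : s((𝒯.adj t i, 𝒯.glue t i i), 𝒯.pairedFace (𝒯.adj t i, 𝒯.glue t i i)) =
          s((t, i), 𝒯.pairedFace (t, i)) := 𝒯.pair_eq_iff.2 (.inr rfl)
      rw [h3] at h2
      exact add_left_cancel (h1.trans h2.symm)
    · have hI' := mt (𝒯.isIdeal_glue t (Ne.symm hi)).1 hI
      simp only [u, hI, hI', dif_neg, not_false_eq_true]
  have hclass : ∀ x y, Relation.EqvGen 𝒯.VertexStep x y → u x = u y := by
    intro x y h
    induction h with
    | rel _ _ h => exact hstep _ _ h
    | refl _ => rfl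
    | symm _ _ _ ih => exact ih.symm
    | trans _ _ _ _ _ ih1 ih2 => exact ih1.trans ih2
  have hu : ∀ t v, 𝒯.IsIdeal t v → u (t, v) = 0 := by
    intro t v hI
    obtain ⟨w, hw, hIw, hκ⟩ := ch.exists_ideal_drop ⟨_, hI⟩
    rw [← hclass _ _ (Quotient.exact hκ)]
    have h := hWu _ _ _ hw hIw
    have hW : W s(ch.drop ⟨_, hI⟩, 𝒯.pairedFace (ch.drop ⟨_, hI⟩)) = 0 :=
      dif_neg fun h => h.2 _ rfl
    exact (zero_add _).symm.trans ((congrArg (· + _) hW.symm).trans h)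
  refine LinearMap.pi_ext' fun j => LinearMap.ext_ring ?_
  rcases j with ⟨q, hq⟩ | ⟨t, v, hI⟩
  · obtain ⟨⟨F, ⟨v, hv, hI⟩, rfl⟩, hq'⟩ := id hq
    have h := hWu _ _ _ hv hI
    rw [hu _ _ hI, add_zero] at h
    simp only [W] at h
    rw [dif_pos hq] at h
    exact h
  · have h := hu t v hI
    simp only [u] at h
    rw [dif_pos hI] at h
    exact h

theorem exists_pairSum_eq [Finite T] (hgood : 𝒯.IsGood) (c : ch.SigmaEq → ℝ) :
    ∃ τ : T × Fin 4 → ℝ, (∀ q, pairSum τ q.1 = c q) ∧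
      ∀ t v, 𝒯.IsIdeal t v → ∑ i ∈ Finset.univ.erase v, τ (t, i) = 0 := by
  obtain ⟨τ, hτ⟩ := ch.faceSums_surjective hgood (Sum.elim c 0)
  refine ⟨τ, fun q => congrFun hτ (.inl q), fun t v hI => ?_⟩
  have h := congrFun hτ (.inr ⟨t, v, hI⟩)
  have hv : v = NoncompactTet.vertex ⟨t, v, hI⟩ :=
    hgood t _ _ hI (NoncompactTet.isIdeal_vertex ⟨t, v, hI⟩)
  exact (Finset.sum_congr (congrArg Finset.univ.erase hv) fun _ _ => rfl).trans h

end EquationChoice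

end Triangulation

/-! ### The matching map -/

/-- The restriction to a tetrahedron of a function on the edges of all the tetrahedra. -/
def restrictTet {T : Type*} (t : T) : (T × TetEdge → ℝ) →L[ℝ] (TetEdge → ℝ) :=
  ContinuousLinearMap.pi fun e => ContinuousLinearMap.proj (t, e)

namespace Triangulation

variable {T : Type*} {𝒯 : Triangulation T}

theorem isGeometric_of_mem_moduli {x : T × TetEdge → ℝ} (hx : x ∈ 𝒯.moduli) (t : T) :
    IsGeometric (𝒯.IsIdeal t) (restrictTet t x) where
  mem_Ioo a b h := by
    unfold ang
    rw [dif_neg h]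
    exact hx.1 t _
  ideal v := (hx.2 t v).1
  nonideal v := (hx.2 t v).2

variable (𝒯) in
/-- The open set where the angles of all the tetrahedra are admissible. -/
def admissible : Set (T × TetEdge → ℝ) := {x | ∀ t, IsAdmissible (𝒯.IsIdeal t) (restrictTet t x)}

theorem moduli_subset_admissible : 𝒯.moduli ⊆ 𝒯.admissible :=
  fun _ hx t => (isGeometric_of_mem_moduli hx t).isAdmissible

theorem isOpen_admissible [Finite T] : IsOpen 𝒯.admissible := by
  have : 𝒯.admissible = ⋂ t, restrictTet t ⁻¹' {θ | IsAdmissible (𝒯.IsIdeal t) θ} := by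
    ext x; simp [admissible]
  rw [this]
  exact isOpen_iInter_of_finite fun t =>
    (isOpen_isAdmissible _).preimage (restrictTet t).continuous

theorem mem_moduli_iff {x : T × TetEdge → ℝ} (hx : x ∈ 𝒯.admissible) :
    x ∈ 𝒯.moduli ↔ ∀ t v, 𝒯.IsIdeal t v → angleSum (restrictTet t x) v = Real.pi := by
  refine ⟨fun h t v => (h.2 t v).1, fun h => ⟨fun t e => ?_, fun t v => ⟨h t v, (hx t).nonideal v⟩⟩⟩
  obtain ⟨e, hd⟩ := e
  induction e with
  | h a b =>
    have hab : a ≠ b := by simpa using hd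
    have := (hx t).mem_Ioo a b hab
    unfold ang at this
    rwa [dif_neg hab] at this

theorem contDiffAt_edgeLength [Fintype T] {x : T × TetEdge → ℝ} (hx : x ∈ 𝒯.admissible)
    {y : T × TetEdge} (hy : 𝒯.IsCompactEdge y) {n : WithTop ℕ∞} :
    ContDiffAt ℝ n (fun x => edgeLength (restrictTet y.1 x) y.2) x := by
  exact ((hx y.1).contDiffAt_edgeLength y.2 hy).comp x (restrictTet y.1).contDiff.contDiffAt

/-- Goodness makes the chosen ideal vertex in `sigma` the only possible one. -/
theorem sigma_eq (hgood : 𝒯.IsGood) (x : T × TetEdge → ℝ) {F : T × Fin 4} {v : Fin 4}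
    (hv : v ≠ F.2) (hI : 𝒯.IsIdeal F.1 v) : 𝒯.sigma x F = sigmaAt (restrictTet F.1 x) F.2 v := by
  have h : 𝒯.IsExceptional F := ⟨v, hv, hI⟩
  unfold sigma
  rw [dif_pos h, hgood _ _ _ h.choose_spec.2 hI]
  rfl

theorem contDiffAt_sigma [Fintype T] (hgood : 𝒯.IsGood) {x : T × TetEdge → ℝ}
    (hx : x ∈ 𝒯.admissible) {F : T × Fin 4} (hF : 𝒯.IsExceptional F) {n : WithTop ℕ∞} :
    ContDiffAt ℝ n (fun x => 𝒯.sigma x F) x := by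
  obtain ⟨v, hv, hI⟩ := hF
  simp only [fun x => sigma_eq hgood x hv hI]
  exact ((hx F.1).contDiffAt_sigmaAt (hgood F.1) hv hI).comp x
    (restrictTet F.1).contDiff.contDiffAt

namespace EquationChoice

variable (ch : 𝒯.EquationChoice)

/-- The representative of the class of the edge of a length equation. -/
def lengthBase (y : ch.LengthEq) : T × TetEdge :=
  ch.base ⟨Quotient.mk 𝒯.edgeSetoid y.1, y.1, rfl, y.2.1⟩

theorem contDiffAt_matchingMap [Fintype T] (hgood : 𝒯.IsGood) {x : T × TetEdge → ℝ}
    (hx : x ∈ 𝒯.admissible) {n : WithTop ℕ∞} : ContDiffAt ℝ n ch.matchingMap x := by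
  rw [contDiffAt_pi]
  rintro (y | ⟨q, ⟨F, hF, rfl⟩, hq⟩)
  · exact (contDiffAt_edgeLength hx y.2.1).sub
      (contDiffAt_edgeLength hx (ch.isCompactEdge_base _))
  · exact (contDiffAt_sigma hgood hx hF).add (contDiffAt_sigma hgood hx hF.pairedFace)

theorem hasFDerivAt_edgeLength [Fintype T] {x : T × TetEdge → ℝ} (hx : x ∈ 𝒯.admissible)
    {y : T × TetEdge} (hy : 𝒯.IsCompactEdge y) :
    HasFDerivAt (fun x => edgeLength (restrictTet y.1 x) y.2)
      ((fderiv ℝ (fun θ => edgeLength θ y.2) (restrictTet y.1 x)).comp (restrictTet y.1)) x := by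
  exact (((hx y.1).contDiffAt_edgeLength y.2 hy (n := 1)).differentiableAt
    one_ne_zero).hasFDerivAt.comp x (restrictTet y.1).hasFDerivAt

theorem hasFDerivAt_sigma [Fintype T] (hgood : 𝒯.IsGood) {x : T × TetEdge → ℝ} (hx : x ∈ 𝒯.admissible)
    {F : T × Fin 4} {v : Fin 4} (hv : v ≠ F.2) (hI : 𝒯.IsIdeal F.1 v) :
    HasFDerivAt (fun x => 𝒯.sigma x F)
      ((fderiv ℝ (fun θ => sigmaAt θ F.2 v) (restrictTet F.1 x)).comp (restrictTet F.1)) x := by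
  simp only [fun x => sigma_eq hgood x hv hI]
  exact (((hx F.1).contDiffAt_sigmaAt (hgood F.1) hv hI (n := 1)).differentiableAt
    one_ne_zero).hasFDerivAt.comp x (restrictTet F.1).hasFDerivAt

/-- The differential of the matching map takes any value on vectors with prescribed angle sums at
the ideal vertices. -/
theorem exists_fderiv_matchingMap_eq [Fintype T] (hgood : 𝒯.IsGood) {x : T × TetEdge → ℝ}
    (hx : x ∈ 𝒯.moduli) (c : ch.EqIndex → ℝ) (m : T → ℝ) :
    ∃ ξ : T × TetEdge → ℝ, (∀ t v, 𝒯.IsIdeal t v → angleSum (restrictTet t ξ) v = m t) ∧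
      fderiv ℝ ch.matchingMap x ξ = c := by
  classical
  obtain ⟨τ, hτ, hτ0⟩ := ch.exists_pairSum_eq hgood fun q => c (.inr q)
  -- Length variations vanish on the representatives, so each difference equals its prescribed
  -- value.
  let l : T × TetEdge → ℝ := fun y =>
    if h : 𝒯.IsCompactEdge y ∧ ∀ E, ch.base E ≠ y then c (.inl ⟨y, h⟩) else 0
  -- The angles of distinct tetrahedra are independent coordinates, so each tetrahedron is solved
  -- separately.
  choose ξ h1 h2 h3 using fun t => (isGeometric_of_mem_moduli hx t).exists_fderiv_eq (hgood t)
    (fun e => l (t, e)) (fun i => τ (t, i)) (m t) (hτ0 t)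
  have hadm := moduli_subset_admissible hx
  refine ⟨fun y => ξ y.1 y.2, h1, ?_⟩
  have hdiff : DifferentiableAt ℝ ch.matchingMap x :=
    (ch.contDiffAt_matchingMap hgood hadm (n := 1)).differentiableAt one_ne_zero
  have hcomp := hasFDerivAt_pi'.1 hdiff.hasFDerivAt
  have hsigma : ∀ F, 𝒯.IsExceptional F → ∃ L : (T × TetEdge → ℝ) →L[ℝ] ℝ,
      HasFDerivAt (fun x => 𝒯.sigma x F) L x ∧ L (fun y => ξ y.1 y.2) = τ F := by
    rintro F ⟨v, hv, hI⟩
    exact ⟨_, hasFDerivAt_sigma hgood hadm hv hI, h3 F.1 F.2 v hv hI⟩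
  funext j
  rcases j with y | ⟨q, ⟨F, hF, rfl⟩, hq⟩
  · have hb := ch.isCompactEdge_base ⟨Quotient.mk 𝒯.edgeSetoid y.1, y.1, rfl, y.2.1⟩
    have hd := (hcomp (.inl y)).unique
      ((hasFDerivAt_edgeLength hadm y.2.1).sub (hasFDerivAt_edgeLength hadm hb))
    refine ((DFunLike.congr_fun hd fun y => ξ y.1 y.2).trans
      (congrArg₂ (· - ·) (h2 _ _ y.2.1) (h2 _ _ hb))).trans ?_
    have e1 : l y.1 = c (.inl y) := dif_pos y.2
    have e2 : l (ch.lengthBase y) = 0 := dif_neg fun h => h.2 _ rfl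
    exact (congrArg₂ (· - ·) e1 e2).trans (sub_zero _)
  · obtain ⟨L, hL, hLξ⟩ := hsigma F hF
    obtain ⟨L', hL', hLξ'⟩ := hsigma _ hF.pairedFace
    have hd := (hcomp (.inr ⟨s(F, 𝒯.pairedFace F), ⟨F, hF, rfl⟩, hq⟩)).unique (hL.add hL')
    refine (DFunLike.congr_fun hd fun y => ξ y.1 y.2).trans ?_
    change L _ + L' _ = _
    rw [hLξ, hLξ']
    exact hτ ⟨s(F, 𝒯.pairedFace F), ⟨F, hF, rfl⟩, hq⟩

/-- The matching map together with the angle sums at the ideal vertices, whose zeros among the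
admissible angles are the cone structures. -/
def extendedMap (x : T × TetEdge → ℝ) : ch.EqIndex ⊕ 𝒯.NoncompactTet → ℝ :=
  Sum.elim (ch.matchingMap x) fun t => angleSum (restrictTet t.1 x) t.vertex - Real.pi

theorem mem_coneStructures_iff (hgood : 𝒯.IsGood) {x : T × TetEdge → ℝ} (hx : x ∈ 𝒯.admissible) :
    x ∈ ch.coneStructures ↔ ch.extendedMap x = 0 := by
  change (x ∈ 𝒯.moduli ∧ ch.matchingMap x = 0) ↔ _
  rw [mem_moduli_iff hx, and_comm]
  constructor
  · rintro ⟨h1, h2⟩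
    funext j
    rcases j with j | t
    · exact congrFun h1 j
    · exact sub_eq_zero.2 (h2 _ _ t.isIdeal_vertex)
  · intro h
    refine ⟨funext fun j => congrFun h (.inl j), fun t v hI => ?_⟩
    have h1 := sub_eq_zero.1 (congrFun h (.inr ⟨t, v, hI⟩))
    rwa [hgood t _ _ (NoncompactTet.isIdeal_vertex ⟨t, v, hI⟩) hI] at h1

theorem contDiffAt_extendedMap [Fintype T] [Fintype 𝒯.NoncompactTet] (hgood : 𝒯.IsGood)
    {x : T × TetEdge → ℝ}
    (hx : x ∈ 𝒯.admissible) {n : WithTop ℕ∞} : ContDiffAt ℝ n ch.extendedMap x := by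
  rw [contDiffAt_pi]
  rintro (j | t)
  · exact contDiffAt_pi.1 (ch.contDiffAt_matchingMap hgood hx) j
  · exact (((contDiff_angleSum t.vertex).comp (restrictTet t.1).contDiff).sub
      contDiff_const).contDiffAt

/-- The parameter `m` of `exists_fderiv_matchingMap_eq` prescribes the angle sum components
independently of the matching ones. -/
theorem surjective_fderiv_extendedMap [Fintype T] [Fintype 𝒯.NoncompactTet] (hgood : 𝒯.IsGood)
    {x : T × TetEdge → ℝ} (hx : x ∈ 𝒯.moduli) :
    Function.Surjective (fderiv ℝ ch.extendedMap x) := by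
  classical
  intro c
  obtain ⟨ξ, h1, h2⟩ := ch.exists_fderiv_matchingMap_eq hgood hx (fun j => c (.inl j))
    fun t => if h : ∃ v, 𝒯.IsIdeal t v then c (.inr ⟨t, h⟩) else 0
  have hadm := moduli_subset_admissible hx
  have hcomp := hasFDerivAt_pi'.1 ((ch.contDiffAt_extendedMap hgood hadm
    (n := 1)).differentiableAt one_ne_zero).hasFDerivAt
  have hF := hasFDerivAt_pi'.1 ((ch.contDiffAt_matchingMap hgood hadm
    (n := 1)).differentiableAt one_ne_zero).hasFDerivAt
  refine ⟨ξ, funext fun j => ?_⟩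
  rcases j with j | t
  · refine (DFunLike.congr_fun ((hcomp (.inl j)).unique (hF j)) ξ).trans ?_
    exact congrFun h2 j
  · let A : (T × TetEdge → ℝ) →L[ℝ] ℝ :=
      LinearMap.toContinuousLinearMap (angleSumLinear t.vertex ∘ₗ (restrictTet t.1).toLinearMap)
    have hA : HasFDerivAt (fun x => angleSum (restrictTet t.1 x) t.vertex - Real.pi) A x :=
      A.hasFDerivAt.sub_const Real.pi
    refine (DFunLike.congr_fun ((hcomp (.inr t)).unique hA) ξ).trans ?_
    change angleSum (restrictTet t.1 ξ) t.vertex = _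
    rw [h1 _ _ t.isIdeal_vertex, dif_pos t.2]

end EquationChoice

end Triangulation

end TruncTri

end

/-! ### The main theorem. -/

open scoped ContDiff in
theorem mainTheorem9 {T : Type*} [Fintype T] (𝒯 : TruncTri.Triangulation T)
    (hgood : 𝒯.IsGood) (ch : 𝒯.EquationChoice) :
    Even 𝒯.numNoncompactTets ∧
    (Fintype.card ch.EqIndex : ℝ) = 6 * (Fintype.card T : ℝ) - (𝒯.numCompactEdges : ℝ)
      - (3 / 2 : ℝ) * (𝒯.numNoncompactTets : ℝ) - (𝒯.numCusps : ℝ) ∧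
    (∀ x ∈ 𝒯.moduli,
      ContDiffAt ℝ ∞ ch.matchingMap x ∧
      Function.Surjective
        (fun ξ : 𝒯.moduliTangent => fderiv ℝ ch.matchingMap x (ξ : T × TruncTri.TetEdge → ℝ))) ∧
    (∀ x₀ ∈ ch.coneStructures,
      TruncTri.IsSmoothManifoldNear ch.coneStructures
        (𝒯.numCompactEdges + 𝒯.numNoncompactTets / 2 + 𝒯.numCusps) x₀) := by
  have h1 := TruncTri.Triangulation.card_exceptional hgood
  have h2 := TruncTri.Triangulation.card_exceptional_eq_two_mul (𝒯 := 𝒯)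
  have h3 := TruncTri.Triangulation.card_compact hgood
  have h4 := ch.card_lengthEq
  have h5 := ch.card_sigmaEq hgood
  have h6 : Fintype.card ch.EqIndex = Nat.card ch.LengthEq + Nat.card ch.SigmaEq := by
    rw [← Nat.card_eq_fintype_card, Nat.card_sum]
  rw [Nat.card_eq_fintype_card (α := T)] at h3
  have heven : Even 𝒯.numNoncompactTets := by
    rw [Nat.even_iff]
    omega
  refine ⟨heven, ?_, fun x hx => ⟨?_, fun c => ?_⟩, fun x₀ hx₀ => ?_⟩
  -- The count is doubled to stay in `ℕ` despite the term `3p/2`.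
  · have h7 : 2 * Fintype.card ch.EqIndex + 2 * 𝒯.numCompactEdges + 3 * 𝒯.numNoncompactTets
        + 2 * 𝒯.numCusps = 12 * Fintype.card T := by omega
    have h8 := congrArg (Nat.cast (R := ℝ)) h7
    push_cast at h8
    linarith
  · exact ch.contDiffAt_matchingMap hgood (TruncTri.Triangulation.moduli_subset_admissible hx)
  -- Prescribing angle sums `0` is tangency to the moduli space.
  · obtain ⟨ξ, hξ, hc⟩ := ch.exists_fderiv_matchingMap_eq hgood hx c 0
    exact ⟨⟨ξ, hξ⟩, hc⟩
  · have : Fintype 𝒯.NoncompactTet := Fintype.ofFinite _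
    have hadm := TruncTri.Triangulation.moduli_subset_admissible hx₀.1
    refine TruncTri.isSmoothManifoldNear_of_surjective_fderiv
      TruncTri.Triangulation.isOpen_admissible
      (fun x hx => ch.contDiffAt_extendedMap hgood hx)
      (fun x hx => ch.mem_coneStructures_iff hgood hx) hadm
      ((ch.mem_coneStructures_iff hgood hadm).1 hx₀)
      (ch.surjective_fderiv_extendedMap hgood hx₀.1) ?_
    have h9 : Fintype.card 𝒯.NoncompactTet = 𝒯.numNoncompactTets :=
      Nat.card_eq_fintype_card.symm
    rw [Module.finrank_fintype_fun_eq_card, Fintype.card_prod,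
      TruncTri.Triangulation.card_tetEdge, Fintype.card_sum, h9]
    -- The extended map has `p` further components, and `6t = (l + p/2 + k) + (6t - l - 3p/2 - k) +
    -- p`; evenness makes the natural division `p / 2` exact.
    obtain ⟨r, hr⟩ := heven
    omega
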